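/- Let $T$ be the unique positive solution of $T\tanh T=1$, let $a=(T\cosh T)^{-1}$, and let $\Sigma\subset\mathbb{B}^3$ be the critical catenoid, i.e. the free boundary minimal annulus parametrized by $$X(s,\theta)=a\,(\cosh s\cos\theta,\ \cosh s\sin\theta,\ s),\qquad s\in[-T,T],\ \theta\in[0,2\pi].$$ Let $Ju=\Delta u-|A|^2u$ be its Jacobi operator, where $\Delta\ge 0$ is the (nonnegative) Laplace--Beltrami operator and $|A|$ is the norm of the second fundamental form, let $\nu$ be the outward unit conormal along $\partial\Sigma$, and let $$Q(u)=\int_\Sigma\left(|\nabla u|^2-|A|^2u^2\right)-\int_{\partial\Sigma}u^2 .$$ Consider the Robin eigenvalue problem $$Ju=\gamma u\ \text{ on }\Sigma,\qquad \frac{\partial u}{\partial\nu}=u\ \text{ on }\partial\Sigma. \qquad (*)$$ Then: 1. Counted with multiplicity, $(*)$ has at least four eigenvalues strictly less than $-2$: there are real numbers $\gamma_1,\dots,\gamma_4<-2$ and linearly independent functions $u_1,\dots,u_4\in C^\infty(\Sigma)$ such that $(\gamma_i,u_i)$ solves $(*)$ for $i=1,\dots,4$. 2. Consequently, at most three orthogonality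 conditions on $u$ never suffice to ensure $Q(u)\ge-2\int_\Sigma u^2$: for every $k\le 3$ and all integrable functions $\varphi_1,\dots,\varphi_k$ on $\Sigma$ there is $u\in C^\infty(\Sigma)$ with $\int_\Sigma\varphi_iu=0$ for all $i\le k$ and $$Q(u)<-2\int_\Sigma u^2 .$$ In particular (take $k=1$ and $\varphi_1=\rho_1$, a first eigenfunction of $(*)$), the naive analogue of Urbano's inequality, "$Q(u)\ge-2\int_\Sigma u^2$ whenever $\int_\Sigma\rho_1u=0$", fails on $\Sigma$. -/

import Mathlib

open scoped ContDiff

noncomputable section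

/-- Euclidean three-space. -/
abbrev E3 : Type := EuclideanSpace ℝ (Fin 3)

/-! Local differential geometry of a surface in `E3` parametrized by an immersion
`X : ℝ × ℝ → E3`.  A function on the surface is given in coordinates by `v : ℝ × ℝ → ℝ`. -/

/-- The partial derivative with respect to the `i`-th coordinate. -/
def pd {F : Type*} [NormedAddCommGroup F] [NormedSpace ℝ F] (i : Fin 2) (f : ℝ × ℝ → F)
    (p : ℝ × ℝ) : F :=
  if i = 0 then deriv (fun t => f (t, p.2)) p.1 else deriv (fun t => f (p.1, t)) p.2

/-- The first fundamental form `g_ij`. -/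
def firstForm (X : ℝ × ℝ → E3) (p : ℝ × ℝ) : Matrix (Fin 2) (Fin 2) ℝ :=
  Matrix.of fun i j => inner ℝ (pd i X p) (pd j X p)

/-- The area density `√(det g)`. -/
def areaDensity (X : ℝ × ℝ → E3) (p : ℝ × ℝ) : ℝ := √((firstForm X p).det)

/-- The vector product of `E3`. -/
def cross (v w : E3) : E3 := WithLp.toLp 2 (crossProduct (WithLp.ofLp v) (WithLp.ofLp w))

/-- The unit normal vector field. -/
def unitNormal (X : ℝ × ℝ → E3) (p : ℝ × ℝ) : E3 :=
  ‖cross (pd 0 X p) (pd 1 X p)‖⁻¹ • cross (pd 0 X p) (pd 1 X p)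

/-- The second fundamental form `h_ij`, with respect to the unit normal. -/
def secondForm (X : ℝ × ℝ → E3) (p : ℝ × ℝ) : Matrix (Fin 2) (Fin 2) ℝ :=
  Matrix.of fun i j => inner ℝ (pd i (pd j X) p) (unitNormal X p)

/-- `|A|² = ∑ g^ik g^jl h_ij h_kl`, the squared norm of the second fundamental form. -/
def normSqA (X : ℝ × ℝ → E3) (p : ℝ × ℝ) : ℝ :=
  ∑ i, ∑ j, ∑ k, ∑ l, (firstForm X p)⁻¹ i k * (firstForm X p)⁻¹ j l *
    secondForm X p i j * secondForm X p k l

/-- The `i`-th component `∑ g^ij ∂_j v` of the gradient of `v`. -/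
def gradComp (X : ℝ × ℝ → E3) (v : ℝ × ℝ → ℝ) (i : Fin 2) (p : ℝ × ℝ) : ℝ :=
  ∑ j, (firstForm X p)⁻¹ i j * pd j v p

/-- `|∇v|² = ∑ g^ij ∂_i v ∂_j v`. -/
def gradNormSq (X : ℝ × ℝ → E3) (v : ℝ × ℝ → ℝ) (p : ℝ × ℝ) : ℝ :=
  ∑ i, pd i v p * gradComp X v i p

/-- The Laplace-Beltrami operator, with the sign that makes it nonnegative:
`Δv = -(det g)^(-1/2) ∑ ∂_i ((det g)^(1/2) g^ij ∂_j v)`. -/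
def laplaceBeltrami (X : ℝ × ℝ → E3) (v : ℝ × ℝ → ℝ) (p : ℝ × ℝ) : ℝ :=
  -((areaDensity X p)⁻¹ * ∑ i, pd i (fun q => areaDensity X q * gradComp X v i q) p)

/-- The Jacobi (stability) operator `J = Δ - |A|²`. -/
def jacobiOp (X : ℝ × ℝ → E3) (v : ℝ × ℝ → ℝ) (p : ℝ × ℝ) : ℝ :=
  laplaceBeltrami X v p - normSqA X p * v p

/-- The derivative of `v` in the direction of `∇s / |∇s|`, where `s` is the first coordinate:
this is the unit vector tangent to the surface, normal to the curves `s = const` and pointing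
towards increasing `s`. -/
def conormalDeriv (X : ℝ × ℝ → E3) (v : ℝ × ℝ → ℝ) (p : ℝ × ℝ) : ℝ :=
  gradComp X v 0 p / √((firstForm X p)⁻¹ 0 0)

/-! The critical catenoid. -/

theorem existsUnique_mul_tanh_eq_one : ∃! T : ℝ, 0 < T ∧ T * Real.tanh T = 1 := by
  have key : ∀ t : ℝ, t * Real.tanh t = 1 ↔ t * Real.sinh t - Real.cosh t = 0 := by
    intro t
    have h := Real.cosh_pos t
    rw [Real.tanh_eq_sinh_div_cosh, mul_div_assoc', div_eq_one_iff_eq h.ne', sub_eq_zero]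
  have hd : ∀ t : ℝ, HasDerivAt (fun t : ℝ => t * Real.sinh t - Real.cosh t)
      (t * Real.cosh t) t := by
    intro t
    have := ((hasDerivAt_id t).mul (Real.hasDerivAt_sinh t)).sub (Real.hasDerivAt_cosh t)
    exact this.congr_deriv (by simp)
  have hc : Continuous fun t : ℝ => t * Real.sinh t - Real.cosh t := by fun_prop
  have hm : StrictMonoOn (fun t : ℝ => t * Real.sinh t - Real.cosh t) (Set.Ici 0) := by
    refine strictMonoOn_of_deriv_pos (convex_Ici 0) hc.continuousOn fun t ht => ?_
    rw [interior_Ici] at ht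
    rw [(hd t).deriv]
    exact mul_pos ht (Real.cosh_pos t)
  have h2 : (0 : ℝ) ≤ 2 * Real.sinh 2 - Real.cosh 2 := by
    have e1 := Real.add_one_le_exp (2 : ℝ)
    have e2 : Real.exp (-2) ≤ 1 := Real.exp_le_one_iff.2 (by norm_num)
    rw [Real.sinh_eq, Real.cosh_eq]
    linarith
  obtain ⟨T, hT, hT0⟩ := intermediate_value_Icc (zero_le_two (α := ℝ)) hc.continuousOn
    (show (0 : ℝ) ∈ Set.Icc _ _ from ⟨by simp, h2⟩)
  refine ⟨T, ⟨hT.1.lt_of_ne ?_, (key T).2 hT0⟩, fun S hS => ?_⟩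
  · rintro rfl
    simp at hT0
  · exact hm.injOn (Set.mem_Ici.2 hS.1.le) (Set.mem_Ici.2 hT.1)
      (((key S).1 hS.2).trans hT0.symm)

/-- The unique positive solution `T` of `T tanh T = 1`. -/
def catT : ℝ := existsUnique_mul_tanh_eq_one.choose

theorem catT_spec : 0 < catT ∧ catT * Real.tanh catT = 1 :=
  existsUnique_mul_tanh_eq_one.choose_spec.1

/-- The scaling factor `a = 1 / (T cosh T)`. -/
def catA : ℝ := (catT * Real.cosh catT)⁻¹

/-- The parametrization `X(s, θ) = a (cosh s cos θ, cosh s sin θ, s)`. -/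
def catX (p : ℝ × ℝ) : E3 :=
  catA • !₂[Real.cosh p.1 * Real.cos p.2, Real.cosh p.1 * Real.sin p.2, p.1]

/-- The critical catenoid `Σ`, the image of `[-T, T] × ℝ`. -/
def criticalCatenoid : Set E3 := catX '' (Set.Icc (-catT) catT ×ˢ Set.univ)

/-- The area measure of `Σ` in the coordinates `(s, θ)`, on the fundamental domain
`[-T, T] × (0, 2π]`. -/
def catArea : MeasureTheory.Measure (ℝ × ℝ) :=
  (MeasureTheory.volume.restrict
    (Set.Icc (-catT) catT ×ˢ Set.Ioc 0 (2 * Real.pi))).withDensity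
      fun p => ENNReal.ofReal (areaDensity catX p)

/-- The integral over `Σ` of a function on `Σ`. -/
def integralCat (w : E3 → ℝ) : ℝ := ∫ p, w (catX p) ∂catArea

/-- The integral over `∂Σ` (the circles `s = T` and `s = -T`) with respect to arc length. -/
def integralBdry (w : E3 → ℝ) : ℝ :=
  (∫ θ in (0 : ℝ)..(2 * Real.pi), w (catX (catT, θ)) * ‖pd 1 catX (catT, θ)‖) +
    ∫ θ in (0 : ℝ)..(2 * Real.pi), w (catX (-catT, θ)) * ‖pd 1 catX (-catT, θ)‖

/-- The second variation form
`Q(u) = ∫_Σ (|∇u|² - |A|² u²) - ∫_∂Σ u²`. -/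
def indexForm (u : E3 → ℝ) : ℝ :=
  (∫ p, (gradNormSq catX (u ∘ catX) p - normSqA catX p * u (catX p) ^ 2) ∂catArea) -
    integralBdry fun x => u x ^ 2

/-- The restriction of `u` to `Σ` (for smooth `u : E3 → ℝ`; the smooth functions on the compact
surface with boundary `Σ` are the restrictions of the smooth functions on `E3`) satisfies
`J u = γ u` on `Σ` and `∂u/∂ν = u` on `∂Σ`, where `ν` is the outward unit conormal, which points
towards increasing `s` on the circle `s = T` and towards decreasing `s` on `s = -T`. -/
def SolvesRobin (γ : ℝ) (u : E3 → ℝ) : Prop :=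
  (∀ p : ℝ × ℝ, p.1 ∈ Set.Icc (-catT) catT →
      jacobiOp catX (u ∘ catX) p = γ * u (catX p)) ∧
    (∀ θ : ℝ, conormalDeriv catX (u ∘ catX) (catT, θ) = u (catX (catT, θ))) ∧
    ∀ θ : ℝ, -conormalDeriv catX (u ∘ catX) (-catT, θ) = u (catX (-catT, θ))

end

/-!
The metric of the critical catenoid is conformal, `a² cosh² s (ds² + dθ²)`, and
`|A|² = 2 / (a² cosh⁴ s)`.  Hence `f(s) cos (n θ)` and `f(s) sin (n θ)` solve the Robin problem with
eigenvalue `γ` exactly when `f'' = V f` with `V = n² - 2 / cosh² s - γ a² cosh² s` and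
`T f'(± T) = ± f(± T)` (`solvesRobin_of_separated`).  Four independent eigenfunctions with `γ < -2`
come from `n = 0` with `f` even, `n = 0` with `f` odd, and `n = 1` with `f` even (twice, with
`cos θ` and `sin θ`).

Each `f` is found by shooting in `γ`.  The solution with normalized initial data at `0` depends
continuously on `γ` (`exists_hasDerivAt_linear`), so it suffices that the Robin defect
`T f'(T) - f(T)` is nonnegative at `γ = -3 / a²` and negative at `γ = -2`.  At `γ = -3 / a²` one has
`V ≥ 1`, and Sturm comparison with `cosh` or `sinh` applies because `tanh T = 1 / T` and
`coth T = T ≥ 1 / T`.  At `γ = -2` the solution is compared with the Jacobi functions (the case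
`γ = 0`) `h = tanh s` for the odd mode and `h = 1 / cosh s` for `n = 1`.  The Wronskian `f' h - f h'`
at `T` is `∫ 2 a² cosh² s f h` over `[0, T]`, and `f / h` increases strictly, so the Wronskian is
smaller than `f(T) / h(T) * ∫ 2 a² cosh² s h²` (`IsSol.mul_wronskian_lt`).  The relation
`T tanh T = 1` turns this bound exactly into `T f'(T) < f(T)`.  The even mode with `n = 0` has a
smaller potential than the one with `n = 1` and inherits the inequality; that it stays positive up
to `T` follows by comparison with the Jacobi function `1 - s tanh s`.

The four eigenfunctions are orthogonal in `L²` and for the second variation form, by parity in `s`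
and by integration over `θ`, so `Q(u) < -2 ∫ u²` on their whole span except at `0`
(`indexForm_modeFamily_lt`).  At most three linear conditions leave a nonzero function of this
four-dimensional span.
-/

noncomputable section

/-! ### Linear differential equations with a parameter -/

/-- The terms of the Picard iteration for the linear equation `y' = A y`, `y 0 = y₀`, depending on
a parameter `g`: the solution is the sum of these. -/
def picardTerm {E : Type*} [NormedAddCommGroup E] [NormedSpace ℝ E]
    (A : ℝ → ℝ → E →L[ℝ] E) (y₀ : E) : ℕ → ℝ → ℝ → E
  | 0, _, _ => y₀
  | k + 1, g, s => ∫ r in (0 : ℝ)..s, A g r (picardTerm A y₀ k g r)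

section LinearODE

variable {E : Type*} [NormedAddCommGroup E] [NormedSpace ℝ E]
  {A : ℝ → ℝ → E →L[ℝ] E} {y₀ : E}

theorem continuous_picardTerm (hA : Continuous (Function.uncurry A)) (k : ℕ) :
    Continuous (Function.uncurry (picardTerm A y₀ k)) := by
  induction k with
  | zero => exact continuous_const
  | succ k ih =>
    exact intervalIntegral.continuous_parametric_intervalIntegral_of_continuous
      (X := ℝ × ℝ) (f := fun p r => A p.1 r (picardTerm A y₀ k p.1 r)) (a₀ := 0)
      ((hA.comp (by fun_prop : Continuous fun q : (ℝ × ℝ) × ℝ => (q.1.1, q.2))).clm_apply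
        (ih.comp (by fun_prop : Continuous fun q : (ℝ × ℝ) × ℝ => (q.1.1, q.2))))
      continuous_snd

theorem hasDerivAt_picardTerm_succ [CompleteSpace E] (hA : Continuous (Function.uncurry A)) (k : ℕ)
    (g s : ℝ) :
    HasDerivAt (picardTerm A y₀ (k + 1) g) (A g s (picardTerm A y₀ k g s)) s := by
  have hc : Continuous fun r => A g r (picardTerm A y₀ k g r) :=
    (hA.comp (by fun_prop : Continuous fun r : ℝ => (g, r))).clm_apply
      ((continuous_picardTerm hA k).comp (by fun_prop : Continuous fun r : ℝ => (g, r)))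
  exact intervalIntegral.integral_hasDerivAt_right (hc.intervalIntegrable _ _)
    hc.stronglyMeasurable.stronglyMeasurableAtFilter hc.continuousAt

theorem norm_picardTerm_le {R M g : ℝ}
    (hM : ∀ r, |r| ≤ R → ‖A g r‖ ≤ M) (k : ℕ) {s : ℝ} (hs : |s| ≤ R) :
    ‖picardTerm A y₀ k g s‖ ≤ ‖y₀‖ * ((M * |s|) ^ k / k.factorial) := by
  induction k generalizing s with
  | zero => simp [picardTerm]
  | succ k ih =>
    have h0 : 0 ≤ M := (norm_nonneg _).trans (hM s hs)
    rw [picardTerm, intervalIntegral.norm_intervalIntegral_eq]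
    have hi : MeasureTheory.IntegrableOn
        (fun r : ℝ => ‖y₀‖ * M ^ (k + 1) / k.factorial * |r - 0| ^ k) (Set.uIoc 0 s) :=
      Continuous.integrableOn_uIoc (by fun_prop)
    refine (MeasureTheory.norm_integral_le_of_norm_le hi ?_).trans (le_of_eq ?_)
    · refine (MeasureTheory.ae_restrict_mem measurableSet_uIoc).mono fun r hr => ?_
      have hrs : |r| ≤ |s| := by
        simpa using Set.abs_sub_left_of_mem_uIcc (Set.uIoc_subset_uIcc hr)
      calc ‖A g r (picardTerm A y₀ k g r)‖
          ≤ M * (‖y₀‖ * ((M * |r|) ^ k / k.factorial)) :=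
            ((A g r).le_opNorm _).trans
              (mul_le_mul (hM r (hrs.trans hs)) (ih (hrs.trans hs)) (norm_nonneg _) h0)
        _ = _ := by rw [sub_zero]; ring
    · rw [MeasureTheory.integral_const_mul, integral_pow_abs_sub_uIoc, sub_zero,
        Nat.factorial_succ]
      push_cast
      field_simp
      rw [mul_pow, mul_assoc]

/-- A linear differential equation `y' = A y` whose coefficients depend continuously on time and
on a parameter has a global solution, and the solution depends continuously on time and on the
parameter. -/
theorem exists_hasDerivAt_linear [CompleteSpace E] (hA : Continuous (Function.uncurry A))
    (y₀ : E) :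
    ∃ y : ℝ → ℝ → E, Continuous (Function.uncurry y) ∧
      ∀ g, y g 0 = y₀ ∧ ∀ s, HasDerivAt (y g) (A g s (y g s)) s := by
  have hbd : ∀ R : ℝ, ∃ M : ℝ, 0 ≤ M ∧ ∀ g r, |g| ≤ R → |r| ≤ R → ‖A g r‖ ≤ M := by
    intro R
    obtain ⟨M, hM⟩ := ((isCompact_Icc (a := -R) (b := R)).prod
      (isCompact_Icc (a := -R) (b := R))).exists_bound_of_continuousOn hA.continuousOn
    exact ⟨max M 0, le_max_right _ _, fun g r hg hr =>
      (hM (g, r) ⟨abs_le.1 hg, abs_le.1 hr⟩).trans (le_max_left _ _)⟩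
  have hsum : ∀ M R : ℝ, Summable fun k : ℕ => ‖y₀‖ * ((M * R) ^ k / k.factorial) :=
    fun M R => (Real.summable_pow_div_factorial _).mul_left _
  have hle : ∀ R M : ℝ, 0 ≤ M → (∀ g r, |g| ≤ R → |r| ≤ R → ‖A g r‖ ≤ M) → ∀ k g s, |g| ≤ R →
      |s| ≤ R → ‖picardTerm A y₀ k g s‖ ≤ ‖y₀‖ * ((M * R) ^ k / k.factorial) := by
    intro R M h0 hM k g s hg hs
    refine (norm_picardTerm_le (hM g · hg) k hs).trans ?_
    gcongr
  refine ⟨fun g s => ∑' k, picardTerm A y₀ k g s, ?_, fun g => ⟨?_, fun s => ?_⟩⟩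
  · refine continuous_iff_continuousAt.2 fun p => ?_
    obtain ⟨M, h0, hM⟩ := hbd (‖p‖ + 1)
    have := continuousOn_tsum (s := Metric.closedBall p 1)
      (f := fun k q => Function.uncurry (picardTerm A y₀ k) q)
      (fun k => (continuous_picardTerm hA k).continuousOn) (hsum M (‖p‖ + 1)) (fun k q hq => by
        have hq : ‖q‖ ≤ ‖p‖ + 1 := by
          have := norm_le_norm_add_norm_sub' q p
          rw [mem_closedBall_iff_norm] at hq
          linarith
        exact hle _ M h0 hM k q.1 q.2 ((norm_fst_le q).trans hq) ((norm_snd_le q).trans hq))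
    exact this.continuousAt (Metric.closedBall_mem_nhds p one_pos)
  · beta_reduce
    rw [tsum_eq_single 0]
    · rfl
    · rintro (_ | k) hk
      · exact absurd rfl hk
      · simp [picardTerm]
  · obtain ⟨M, h0, hM⟩ := hbd (max |g| |s| + 1)
    set R := max |g| |s| + 1 with hR
    have hgR : |g| ≤ R := (le_max_left _ _).trans (le_add_of_nonneg_right zero_le_one)
    have hsR : |s| < R := (le_max_right _ _).trans_lt (lt_add_one _)
    have hsm : ∀ r, |r| ≤ R → Summable fun k => picardTerm A y₀ k g r := fun r hr =>
      .of_norm_bounded (hsum M R) fun k => hle R M h0 hM k g r hgR hr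
    have hd := hasDerivAt_tsum_of_isPreconnected (t := Metric.ball (0 : ℝ) R)
      (g := fun k => picardTerm A y₀ (k + 1) g) (y₀ := s) (y := s)
      (g' := fun k r => A g r (picardTerm A y₀ k g r)) ((hsum M R).mul_left M)
      Metric.isOpen_ball (convex_ball (0 : ℝ) R).isPreconnected
      (fun k r _ => hasDerivAt_picardTerm_succ hA k g r)
      (fun k r hr => by
        have hr : |r| ≤ R := by simpa using (Metric.mem_ball.1 hr).le
        exact ((A g r).le_opNorm _).trans
          (mul_le_mul (hM g r hgR hr) (hle R M h0 hM k g r hgR hr) (norm_nonneg _) h0))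
      (by simpa using hsR) ((summable_nat_add_iff 1).2 (hsm s hsR.le)) (by simpa using hsR)
    rw [← (A g s).map_tsum (hsm s hsR.le)] at hd
    refine (hd.const_add y₀).congr_of_eventuallyEq ?_
    filter_upwards [Metric.isOpen_ball.mem_nhds (show s ∈ Metric.ball (0 : ℝ) R by simpa using hsR)]
      with r hr
    exact (hsm r (by simpa using (Metric.mem_ball.1 hr).le)).tsum_eq_zero_add

end LinearODE

/-- A second order linear equation `f'' = V f`, with a coefficient that depends continuously on a
parameter, has a global solution with given initial data, and the solution and its derivative
depend continuously on the parameter. -/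
theorem exists_hasDerivAt_second_order {V : ℝ → ℝ → ℝ} (hV : Continuous (Function.uncurry V))
    (α β : ℝ) :
    ∃ f f' : ℝ → ℝ → ℝ, Continuous (Function.uncurry f) ∧ Continuous (Function.uncurry f') ∧
      ∀ g, f g 0 = α ∧ f' g 0 = β ∧ ∀ s, HasDerivAt (f g) (f' g s) s ∧
        HasDerivAt (f' g) (V g s * f g s) s := by
  let A : ℝ → ℝ → ℝ × ℝ →L[ℝ] ℝ × ℝ := fun g s =>
    ContinuousLinearMap.inl ℝ ℝ ℝ ∘L ContinuousLinearMap.snd ℝ ℝ ℝ +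
      V g s • (ContinuousLinearMap.inr ℝ ℝ ℝ ∘L ContinuousLinearMap.fst ℝ ℝ ℝ)
  have hA : Continuous (Function.uncurry A) :=
    continuous_const.add (hV.smul continuous_const)
  obtain ⟨y, hy, h⟩ := exists_hasDerivAt_linear hA (α, β)
  refine ⟨fun g s => (y g s).1, fun g s => (y g s).2, continuous_fst.comp hy,
    continuous_snd.comp hy, fun g => ⟨by simp [(h g).1], by simp [(h g).1], fun s => ⟨?_, ?_⟩⟩⟩
  · exact ((ContinuousLinearMap.fst ℝ ℝ ℝ).hasFDerivAt.comp_hasDerivAt s ((h g).2 s)).congr_deriv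
      (by simp [A])
  · exact ((ContinuousLinearMap.snd ℝ ℝ ℝ).hasFDerivAt.comp_hasDerivAt s ((h g).2 s)).congr_deriv
      (by simp [A])

theorem hasDerivAt_comp_neg {f : ℝ → ℝ} {f' s : ℝ} (h : HasDerivAt f f' (-s)) :
    HasDerivAt (fun t => f (-t)) (-f') s := by
  exact (h.comp s (hasDerivAt_neg s)).congr_deriv (by simp)

/-- If the coefficient is even in time, the equation has an even solution with value `1` at `0`:
the even part of any such solution. -/
theorem exists_even_solution {V : ℝ → ℝ → ℝ} (hV : Continuous (Function.uncurry V))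
    (hev : ∀ g s, V g (-s) = V g s) :
    ∃ f f' : ℝ → ℝ → ℝ, Continuous (Function.uncurry f) ∧ Continuous (Function.uncurry f') ∧
      ∀ g, f g 0 = 1 ∧ f' g 0 = 0 ∧ (∀ s, f g (-s) = f g s) ∧ ∀ s, HasDerivAt (f g) (f' g s) s ∧
        HasDerivAt (f' g) (V g s * f g s) s := by
  obtain ⟨f, f', hf, hf', h⟩ := exists_hasDerivAt_second_order hV 1 0
  have hn : Continuous fun p : ℝ × ℝ => (p.1, -p.2) := by fun_prop
  refine ⟨fun g s => (f g s + f g (-s)) / 2, fun g s => (f' g s - f' g (-s)) / 2,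
    (hf.add (hf.comp hn)).div_const 2, (hf'.sub (hf'.comp hn)).div_const 2,
    fun g => ⟨by simp [(h g).1], by simp, fun s => by beta_reduce; rw [neg_neg, add_comm], fun s => ⟨?_, ?_⟩⟩⟩
  · exact ((((h g).2.2 s).1.add (hasDerivAt_comp_neg ((h g).2.2 (-s)).1)).div_const 2).congr_deriv
      (by ring)
  · exact ((((h g).2.2 s).2.sub (hasDerivAt_comp_neg ((h g).2.2 (-s)).2)).div_const 2).congr_deriv
      (by rw [hev]; ring)

/-- If the coefficient is even in time, the equation has an odd solution with derivative `1` at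
`0`: the odd part of any such solution. -/
theorem exists_odd_solution {V : ℝ → ℝ → ℝ} (hV : Continuous (Function.uncurry V))
    (hev : ∀ g s, V g (-s) = V g s) :
    ∃ f f' : ℝ → ℝ → ℝ, Continuous (Function.uncurry f) ∧ Continuous (Function.uncurry f') ∧
      ∀ g, f g 0 = 0 ∧ f' g 0 = 1 ∧ (∀ s, f g (-s) = -f g s) ∧ ∀ s, HasDerivAt (f g) (f' g s) s ∧
        HasDerivAt (f' g) (V g s * f g s) s := by
  obtain ⟨f, f', hf, hf', h⟩ := exists_hasDerivAt_second_order hV 0 1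
  have hn : Continuous fun p : ℝ × ℝ => (p.1, -p.2) := by fun_prop
  refine ⟨fun g s => (f g s - f g (-s)) / 2, fun g s => (f' g s + f' g (-s)) / 2,
    (hf.sub (hf.comp hn)).div_const 2, (hf'.add (hf'.comp hn)).div_const 2,
    fun g => ⟨by simp, by simp [(h g).2.1], fun s => by beta_reduce; rw [neg_neg]; ring, fun s => ⟨?_, ?_⟩⟩⟩
  · exact ((((h g).2.2 s).1.sub (hasDerivAt_comp_neg ((h g).2.2 (-s)).1)).div_const 2).congr_deriv
      (by ring)
  · exact ((((h g).2.2 s).2.add (hasDerivAt_comp_neg ((h g).2.2 (-s)).2)).div_const 2).congr_deriv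
      (by rw [hev]; ring)

/-- Solutions of `f'' = V f` with smooth `V` are smooth. -/
theorem contDiff_of_hasDerivAt_second_order {V f f' : ℝ → ℝ} (hV : ContDiff ℝ ∞ V)
    (h : ∀ s, HasDerivAt f (f' s) s ∧ HasDerivAt f' (V s * f s) s) : ContDiff ℝ ∞ f := by
  have hd : deriv f = f' := funext fun s => (h s).1.deriv
  have hd' : deriv f' = V * f := funext fun s => (h s).2.deriv
  have key : ∀ n : ℕ, ContDiff ℝ n f ∧ ContDiff ℝ n f' := by
    intro n
    induction n with
    | zero =>
      exact ⟨contDiff_zero.2 (continuous_iff_continuousAt.2 fun s => (h s).1.continuousAt),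
        contDiff_zero.2 (continuous_iff_continuousAt.2 fun s => (h s).2.continuousAt)⟩
    | succ n ih =>
      push_cast
      simp only [contDiff_succ_iff_deriv, hd, hd']
      exact ⟨⟨fun s => (h s).1.differentiableAt, by simp, ih.2⟩,
        fun s => (h s).2.differentiableAt, by simp,
        (hV.of_le (by exact_mod_cast le_top)).mul ih.1⟩
  exact contDiff_infty.2 fun n => (key n).1

/-! ### Sturm comparison -/

/-- `f` is a solution of `f'' = V f` on the whole line, with derivative `f'`. -/
def IsSol (V f f' : ℝ → ℝ) : Prop :=
  ∀ s, HasDerivAt f (f' s) s ∧ HasDerivAt f' (V s * f s) s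

section Sturm

variable {V V₀ f f' h h' : ℝ → ℝ} {T : ℝ}

theorem IsSol.continuous (hf : IsSol V f f') : Continuous f :=
  continuous_iff_continuousAt.2 fun s => (hf s).1.continuousAt

theorem IsSol.hasDerivAt_wronskian (hf : IsSol V f f') (hh : IsSol V₀ h h') (s : ℝ) :
    HasDerivAt (fun s => f' s * h s - f s * h' s) ((V s - V₀ s) * (f s * h s)) s :=
  (((hf s).2.mul (hh s).1).sub ((hf s).1.mul (hh s).2)).congr_deriv (by ring)

theorem IsSol.hasDerivAt_div (hf : IsSol V f f') (hh : IsSol V₀ h h') {s : ℝ} (hs : h s ≠ 0) :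
    HasDerivAt (fun s => f s / h s) ((f' s * h s - f s * h' s) / h s ^ 2) s :=
  (hf s).1.div (hh s).1 hs

theorem IsSol.continuous_wronskian (hf : IsSol V f f') (hh : IsSol V₀ h h') :
    Continuous fun s => f' s * h s - f s * h' s :=
  continuous_iff_continuousAt.2 fun s => (hf.hasDerivAt_wronskian hh s).continuousAt

theorem IsSol.monotoneOn_wronskian (hf : IsSol V f f') (hh : IsSol V₀ h h')
    (hV : ∀ s ∈ Set.Ioo 0 T, V₀ s ≤ V s) (hfp : ∀ s ∈ Set.Ioo 0 T, 0 ≤ f s)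
    (hhp : ∀ s ∈ Set.Ioo 0 T, 0 ≤ h s) :
    MonotoneOn (fun s => f' s * h s - f s * h' s) (Set.Icc 0 T) := by
  refine monotoneOn_of_deriv_nonneg (convex_Icc 0 T) (hf.continuous_wronskian hh).continuousOn
    (fun s _ => (hf.hasDerivAt_wronskian hh s).differentiableAt.differentiableWithinAt)
    fun s hs => ?_
  rw [interior_Icc] at hs
  rw [(hf.hasDerivAt_wronskian hh s).deriv]
  exact mul_nonneg (sub_nonneg.2 (hV s hs)) (mul_nonneg (hfp s hs) (hhp s hs))

theorem IsSol.strictMonoOn_wronskian (hf : IsSol V f f') (hh : IsSol V₀ h h')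
    (hV : ∀ s ∈ Set.Ioo 0 T, V₀ s < V s) (hfp : ∀ s ∈ Set.Ioo 0 T, 0 < f s)
    (hhp : ∀ s ∈ Set.Ioo 0 T, 0 < h s) :
    StrictMonoOn (fun s => f' s * h s - f s * h' s) (Set.Icc 0 T) := by
  refine strictMonoOn_of_deriv_pos (convex_Icc 0 T) (hf.continuous_wronskian hh).continuousOn
    fun s hs => ?_
  rw [interior_Icc] at hs
  rw [(hf.hasDerivAt_wronskian hh s).deriv]
  exact mul_pos (sub_pos.2 (hV s hs)) (mul_pos (hfp s hs) (hhp s hs))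

/-- Sturm comparison: if `V₀ ≤ V` and `h` is a positive solution for `V₀` with the same
logarithmic derivative at `0` as `f`, then `f` stays positive as long as `h` does, because
`f / h` increases up to the first zero of `f`. -/
theorem IsSol.pos_of_comparison (hf : IsSol V f f') (hh : IsSol V₀ h h')
    (hV : ∀ s ∈ Set.Ioo 0 T, V₀ s ≤ V s) (hhp : ∀ s ∈ Set.Ioo 0 T, 0 < h s)
    (h0 : f' 0 * h 0 - f 0 * h' 0 = 0) (hf0 : ∀ᶠ s in nhdsWithin 0 (Set.Ioi 0), 0 < f s) :
    ∀ s ∈ Set.Ioo 0 T, 0 < f s := by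
  by_contra! hcon
  obtain ⟨s₁, hs₁, hs₁f⟩ := hcon
  obtain ⟨δ, hδ, hδf⟩ := mem_nhdsGT_iff_exists_Ioc_subset.1 hf0
  have hδ : 0 < δ := hδ
  have hδs₁ : δ < s₁ := by
    by_contra! hle
    exact (hδf ⟨hs₁.1, hle⟩ : 0 < f s₁).not_ge hs₁f
  obtain ⟨s₀, ⟨hs₀, hs₀f⟩, hmin⟩ := ((isCompact_Icc (a := δ) (b := s₁)).inter_right
    (isClosed_le hf.continuous continuous_const : IsClosed {s | f s ≤ 0})).exists_isLeast
      ⟨s₁, ⟨hδs₁.le, le_rfl⟩, hs₁f⟩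
  have hs₀T : s₀ < T := hs₀.2.trans_lt hs₁.2
  have hpos : ∀ s ∈ Set.Ioo 0 s₀, 0 < f s := by
    intro s hs
    rcases le_or_gt s δ with hsδ | hsδ
    · exact hδf ⟨hs.1, hsδ⟩
    · by_contra! hle
      exact (hmin ⟨⟨hsδ.le, hs.2.le.trans hs₀.2⟩, hle⟩).not_gt hs.2
  have hW := hf.monotoneOn_wronskian hh (T := s₀) (fun s hs => hV s ⟨hs.1, hs.2.trans hs₀T⟩)
    (fun s hs => (hpos s hs).le) (fun s hs => (hhp s ⟨hs.1, hs.2.trans hs₀T⟩).le)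
  have hhI : ∀ s ∈ Set.Icc δ s₀, 0 < h s := fun s hs =>
    hhp s ⟨hδ.trans_le hs.1, hs.2.trans_lt hs₀T⟩
  have hmono : MonotoneOn (fun s => f s / h s) (Set.Icc δ s₀) := by
    refine monotoneOn_of_deriv_nonneg (convex_Icc δ s₀)
      (fun s hs => (hf.hasDerivAt_div hh (hhI s hs).ne').continuousAt.continuousWithinAt)
      (fun s hs => (hf.hasDerivAt_div hh
        (hhI s (interior_subset hs)).ne').differentiableAt.differentiableWithinAt) fun s hs => ?_
    have hs := interior_subset hs
    rw [(hf.hasDerivAt_div hh (hhI s hs).ne').deriv]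
    refine div_nonneg ?_ (sq_nonneg _)
    rw [← h0]
    exact hW ⟨le_rfl, hδ.le.trans (hs.1.trans hs.2)⟩ ⟨hδ.le.trans hs.1, hs.2⟩ (hδ.le.trans hs.1)
  have h1 := hmono ⟨le_rfl, hs₀.1⟩ ⟨hs₀.1, le_rfl⟩ hs₀.1
  have h2 : 0 < f δ / h δ := div_pos (hδf ⟨hδ, le_rfl⟩) (hhI δ ⟨le_rfl, hs₀.1⟩)
  have h3 : f s₀ / h s₀ ≤ 0 := div_nonpos_of_nonpos_of_nonneg hs₀f (hhI s₀ ⟨hs₀.1, le_rfl⟩).le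
  simp only at h1
  linarith

/-- Quantitative Sturm comparison.  The Wronskian at `T` is `∫ (V - V₀) f h`; since `f / h`
increases strictly, `f h(T) < f(T) h` before `T`, and the integral is less than
`f(T) / h(T)` times `K(T) = ∫ (V - V₀) h²`. -/
theorem IsSol.mul_wronskian_lt (hf : IsSol V f f') (hh : IsSol V₀ h h') (hT : 0 < T)
    (hV : ∀ s ∈ Set.Ioo 0 T, V₀ s < V s) (hhp : ∀ s ∈ Set.Ioc 0 T, 0 < h s)
    (h0 : f' 0 * h 0 - f 0 * h' 0 = 0) (hf0 : ∀ᶠ s in nhdsWithin 0 (Set.Ioi 0), 0 < f s)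
    {K : ℝ → ℝ} (hK : ∀ s, HasDerivAt K ((V s - V₀ s) * h s ^ 2) s) (hK0 : K 0 = 0) :
    h T * (f' T * h T - f T * h' T) < f T * K T := by
  have hhp' : ∀ s ∈ Set.Ioo 0 T, 0 < h s := fun s hs => hhp s ⟨hs.1, hs.2.le⟩
  have hfp := hf.pos_of_comparison hh (fun s hs => (hV s hs).le) hhp' h0 hf0
  have hW := hf.strictMonoOn_wronskian hh hV hfp hhp'
  have hmono : StrictMonoOn (fun s => f s / h s) (Set.Ioc 0 T) := by
    refine strictMonoOn_of_deriv_pos (convex_Ioc 0 T)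
      (fun s hs => (hf.hasDerivAt_div hh (hhp s hs).ne').continuousAt.continuousWithinAt)
      fun s hs => ?_
    have hs := interior_subset hs
    rw [(hf.hasDerivAt_div hh (hhp s hs).ne').deriv]
    refine div_pos ?_ (pow_pos (hhp s hs) 2)
    rw [← h0]
    exact hW ⟨le_rfl, hT.le⟩ ⟨hs.1.le, hs.2⟩ hs.1
  have hd : ∀ s, HasDerivAt (fun s => f T * K s - h T * (f' s * h s - f s * h' s))
      ((V s - V₀ s) * h s * (f T * h s - f s * h T)) s := fun s =>
    (((hK s).const_mul _).sub ((hf.hasDerivAt_wronskian hh s).const_mul _)).congr_deriv (by ring)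
  have hχ : StrictMonoOn (fun s => f T * K s - h T * (f' s * h s - f s * h' s))
      (Set.Icc 0 T) := by
    refine strictMonoOn_of_deriv_pos (convex_Icc 0 T)
      (fun s _ => (hd s).continuousAt.continuousWithinAt) fun s hs => ?_
    rw [interior_Icc] at hs
    rw [(hd s).deriv]
    refine mul_pos (mul_pos (sub_pos.2 (hV s hs)) (hhp' s hs)) (sub_pos.2 ?_)
    have := hmono ⟨hs.1, hs.2.le⟩ ⟨hT, le_rfl⟩ hs.2
    simp only at this
    rwa [div_lt_div_iff₀ (hhp' s hs) (hhp T ⟨hT, le_rfl⟩)] at this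
  have := hχ ⟨le_rfl, hT.le⟩ ⟨hT.le, le_rfl⟩ hT
  simp only [hK0, h0] at this
  linarith

theorem eventually_pos_of_one (hf : IsSol V f f') (h0 : f 0 = 1) :
    ∀ᶠ s in nhdsWithin 0 (Set.Ioi 0), 0 < f s :=
  ((hf.continuous.tendsto 0).eventually (lt_mem_nhds (by rw [h0]; exact one_pos))).filter_mono
    nhdsWithin_le_nhds

theorem eventually_pos_of_deriv_one (hf : IsSol V f f') (h0 : f 0 = 0) (h0' : f' 0 = 1) :
    ∀ᶠ s in nhdsWithin 0 (Set.Ioi 0), 0 < f s := by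
  have h1 := (hasDerivAt_iff_tendsto_slope.1 (hf 0).1).mono_left
    (nhdsWithin_mono 0 fun s (hs : 0 < s) => hs.ne')
  filter_upwards [h1.eventually (lt_mem_nhds (by rw [h0']; exact one_pos)), self_mem_nhdsWithin]
    with s hs hs0
  rw [slope_def_field, h0, sub_zero, sub_zero] at hs
  exact (div_pos_iff_of_pos_right hs0).1 hs

end Sturm

/-! ### Numbers attached to the critical catenoid -/

theorem catT_pos : 0 < catT := catT_spec.1

theorem catT_mul_sinh : catT * Real.sinh catT = Real.cosh catT := by
  have h := catT_spec.2
  have hc := Real.cosh_pos catT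
  rw [Real.tanh_eq_sinh_div_cosh] at h
  field_simp at h
  exact h

theorem sinh_catT : Real.sinh catT = Real.cosh catT / catT := by
  rw [eq_div_iff catT_pos.ne', mul_comm, catT_mul_sinh]

theorem tanh_catT : Real.tanh catT = 1 / catT := by
  rw [eq_div_iff catT_pos.ne', mul_comm, catT_spec.2]

theorem one_lt_catT : 1 < catT := by
  have h := catT_spec.2
  nlinarith [Real.tanh_lt_one catT, catT_pos]

theorem catA_pos : 0 < catA := inv_pos.2 (mul_pos catT_pos (Real.cosh_pos _))

theorem catA_mul_cosh : catA * Real.cosh catT = 1 / catT := by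
  have := Real.cosh_pos catT
  have := catT_pos
  rw [catA]
  field_simp

theorem cosh_catT_sq : Real.cosh catT ^ 2 * (catT ^ 2 - 1) = catT ^ 2 := by
  have h := Real.cosh_sq catT
  have h1 := catT_mul_sinh
  linear_combination catT ^ 2 * h + (catT * Real.sinh catT + Real.cosh catT) * h1

theorem catA_sq : catA ^ 2 = (catT ^ 2 - 1) / catT ^ 4 := by
  have h1 := catA_mul_cosh
  have h2 := cosh_catT_sq
  have hT := catT_pos
  have hc := Real.cosh_pos catT
  rw [eq_div_iff (by positivity)]
  have h3 : catA ^ 2 * Real.cosh catT ^ 2 * catT ^ 2 = 1 := by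
    rw [← mul_pow, h1]; field_simp
  linear_combination (-catA ^ 2 * catT ^ 2) * h2 + (catT ^ 2 - 1) * h3

theorem catA_lt_one : catA < 1 := by
  refine inv_lt_one_of_one_lt₀ ?_
  nlinarith [one_lt_catT, Real.one_le_cosh catT]

/-! ### The Jacobi equation on a Fourier mode -/

/-- The potential of the equation `f'' = V f` satisfied by `f` when `f(s) cos (n θ)` is an
eigenfunction of the Jacobi operator with eigenvalue `γ` and `c = n²`. -/
def jacobiPotential (c γ s : ℝ) : ℝ :=
  c - 2 / Real.cosh s ^ 2 - γ * (catA ^ 2 * Real.cosh s ^ 2)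

theorem contDiff_jacobiPotential (c γ : ℝ) : ContDiff ℝ ∞ (jacobiPotential c γ) := by
  unfold jacobiPotential
  exact (contDiff_const.sub (contDiff_const.div (Real.contDiff_cosh.pow 2)
    fun s => (pow_pos (Real.cosh_pos s) 2).ne')).sub
      (contDiff_const.mul (contDiff_const.mul (Real.contDiff_cosh.pow 2)))

theorem continuous_jacobiPotential (c : ℝ) : Continuous (Function.uncurry (jacobiPotential c)) := by
  have h : ∀ p : ℝ × ℝ, Real.cosh p.2 ^ 2 ≠ 0 := fun p => (pow_pos (Real.cosh_pos p.2) 2).ne'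
  have hc : Continuous fun p : ℝ × ℝ => Real.cosh p.2 := Real.continuous_cosh.comp continuous_snd
  exact (continuous_const.sub (continuous_const.div (hc.pow 2) h)).sub
    (continuous_fst.mul (continuous_const.mul (hc.pow 2)))

theorem jacobiPotential_neg (c γ s : ℝ) : jacobiPotential c γ (-s) = jacobiPotential c γ s := by
  simp [jacobiPotential]

theorem hasDerivAt_tanh (s : ℝ) : HasDerivAt Real.tanh (1 / Real.cosh s ^ 2) s := by
  have h := (Real.hasDerivAt_sinh s).div (Real.hasDerivAt_cosh s) (Real.cosh_pos s).ne'
  have he : Real.tanh = fun s => Real.sinh s / Real.cosh s := funext Real.tanh_eq_sinh_div_cosh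
  rw [he]
  refine h.congr_deriv ?_
  rw [← pow_two, ← pow_two, Real.cosh_sq]
  ring

theorem strictMono_tanh : StrictMono Real.tanh := by
  refine strictMono_of_deriv_pos fun s => ?_
  rw [(hasDerivAt_tanh s).deriv]
  exact one_div_pos.2 (pow_pos (Real.cosh_pos s) 2)

theorem tanh_pos {s : ℝ} (hs : 0 < s) : 0 < Real.tanh s :=
  Real.tanh_zero ▸ strictMono_tanh hs

theorem hasDerivAt_inv_cosh_sq (s : ℝ) :
    HasDerivAt (fun s => 1 / Real.cosh s ^ 2) (-2 * Real.sinh s / Real.cosh s ^ 3) s := by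
  have h := (((Real.hasDerivAt_cosh s).pow 2).fun_inv (pow_pos (Real.cosh_pos s) 2).ne')
  have hc := Real.cosh_pos s
  simp only [one_div]
  refine h.congr_deriv ?_
  simp only [Pi.pow_apply]
  field_simp
  push_cast
  ring

/-- Translations along the axis give the Jacobi function `tanh s`. -/
theorem isSol_tanh : IsSol (jacobiPotential 0 0) Real.tanh (fun s => 1 / Real.cosh s ^ 2) := by
  refine fun s => ⟨hasDerivAt_tanh s, (hasDerivAt_inv_cosh_sq s).congr_deriv ?_⟩
  have hc := Real.cosh_pos s
  rw [jacobiPotential, Real.tanh_eq_sinh_div_cosh]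
  field_simp
  ring

/-- Translations orthogonal to the axis give the Jacobi functions `cos θ / cosh s` and
`sin θ / cosh s`. -/
theorem isSol_inv_cosh : IsSol (jacobiPotential 1 0) (fun s => 1 / Real.cosh s)
    (fun s => -Real.sinh s / Real.cosh s ^ 2) := by
  intro s
  have hc := Real.cosh_pos s
  constructor
  · have h := (Real.hasDerivAt_cosh s).fun_inv hc.ne'
    simp only [one_div]
    exact h
  · have h := ((Real.hasDerivAt_sinh s).neg).div ((Real.hasDerivAt_cosh s).pow 2)
      (pow_pos hc 2).ne'
    refine h.congr_deriv ?_
    simp only [Pi.pow_apply, Pi.neg_apply, jacobiPotential]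
    field_simp
    rw [Real.sinh_sq]
    push_cast
    ring

/-- Dilations give the Jacobi function `1 - s tanh s`, which vanishes on the boundary. -/
theorem isSol_support : IsSol (jacobiPotential 0 0) (fun s => 1 - s * Real.tanh s)
    (fun s => -(Real.tanh s + s * (1 / Real.cosh s ^ 2))) := by
  intro s
  have hc := Real.cosh_pos s
  constructor
  · exact (((hasDerivAt_id s).mul (hasDerivAt_tanh s)).const_sub 1).congr_deriv (by simp)
  · refine ((hasDerivAt_tanh s).add
      ((hasDerivAt_id s).mul (hasDerivAt_inv_cosh_sq s))).neg.congr_deriv ?_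
    simp only [jacobiPotential, Real.tanh_eq_sinh_div_cosh, id]
    field_simp
    ring

theorem isSol_cosh : IsSol (fun _ => 1) Real.cosh Real.sinh := fun s =>
  ⟨Real.hasDerivAt_cosh s, (Real.hasDerivAt_sinh s).congr_deriv (by simp)⟩

theorem isSol_sinh : IsSol (fun _ => 1) Real.sinh Real.cosh := fun s =>
  ⟨Real.hasDerivAt_sinh s, (Real.hasDerivAt_cosh s).congr_deriv (by simp)⟩

theorem jacobiPotential_lt {c γ : ℝ} (hγ : γ < 0) (s : ℝ) :
    jacobiPotential c 0 s < jacobiPotential c γ s := by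
  have : 0 < catA ^ 2 * Real.cosh s ^ 2 := by
    have := catA_pos; have := Real.cosh_pos s; positivity
  simp only [jacobiPotential]
  nlinarith

theorem one_le_jacobiPotential {c : ℝ} (hc : 0 ≤ c) (s : ℝ) :
    1 ≤ jacobiPotential c (-3 / catA ^ 2) s := by
  have ha := catA_pos
  have h1 := Real.one_le_cosh s
  have h2 : 2 / Real.cosh s ^ 2 ≤ 2 := div_le_self zero_le_two (by nlinarith)
  have h3 : -3 / catA ^ 2 * (catA ^ 2 * Real.cosh s ^ 2) = -3 * Real.cosh s ^ 2 := by field_simp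
  rw [jacobiPotential, h3]
  nlinarith

/-! ### The Robin defect `T f'(T) - f(T)` -/

section Robin

variable {f f' : ℝ → ℝ} {c : ℝ}

/-- Comparison with `cosh`, whose Robin defect vanishes. -/
theorem robin_nonneg_of_even (hc : 0 ≤ c) (hf : IsSol (jacobiPotential c (-3 / catA ^ 2)) f f')
    (h0 : f 0 = 1) (h0' : f' 0 = 0) : 0 ≤ catT * f' catT - f catT := by
  have hW0 : f' 0 * Real.cosh 0 - f 0 * Real.sinh 0 = 0 := by simp [h0']
  have hp := hf.pos_of_comparison isSol_cosh (T := catT) (fun s _ => one_le_jacobiPotential hc s)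
    (fun s _ => Real.cosh_pos s) hW0 (eventually_pos_of_one hf h0)
  have hW := hf.monotoneOn_wronskian isSol_cosh (T := catT)
    (fun s _ => one_le_jacobiPotential hc s) (fun s hs => (hp s hs).le)
    (fun s _ => (Real.cosh_pos s).le) ⟨le_rfl, catT_pos.le⟩ ⟨catT_pos.le, le_rfl⟩ catT_pos.le
  simp only [hW0] at hW
  have hT := catT_pos
  refine nonneg_of_mul_nonneg_left ?_ (Real.cosh_pos catT)
  have := mul_nonneg hT.le hW
  linear_combination this - f catT * catT_mul_sinh

/-- Comparison with `sinh`, whose logarithmic derivative at `T` is `coth T = T > 1 / T`. -/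
theorem robin_nonneg_of_odd (hc : 0 ≤ c) (hf : IsSol (jacobiPotential c (-3 / catA ^ 2)) f f')
    (h0 : f 0 = 0) (h0' : f' 0 = 1) : 0 ≤ catT * f' catT - f catT := by
  have hW0 : f' 0 * Real.sinh 0 - f 0 * Real.cosh 0 = 0 := by simp [h0]
  -- Positivity is needed at `T` itself, so the comparison runs past it.
  have hp := hf.pos_of_comparison isSol_sinh (T := catT + 1)
    (fun s _ => one_le_jacobiPotential hc s)
    (fun s hs => Real.sinh_pos_iff.2 hs.1) hW0 (eventually_pos_of_deriv_one hf h0 h0')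
  have hpT := hp catT ⟨catT_pos, lt_add_one _⟩
  have hW := hf.monotoneOn_wronskian isSol_sinh (T := catT)
    (fun s _ => one_le_jacobiPotential hc s) (fun s hs => (hp s ⟨hs.1, by linarith [hs.2]⟩).le)
    (fun s hs => (Real.sinh_pos_iff.2 hs.1).le) ⟨le_rfl, catT_pos.le⟩ ⟨catT_pos.le, le_rfl⟩
    catT_pos.le
  simp only [hW0] at hW
  have hT := one_lt_catT
  have hs : 0 < Real.sinh catT := Real.sinh_pos_iff.2 catT_pos
  have h1 : 0 ≤ f' catT - catT * f catT := by
    refine nonneg_of_mul_nonneg_left ?_ hs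
    linear_combination hW + f catT * catT_mul_sinh
  nlinarith [mul_pos hpT (sub_pos.2 hT)]

/-- Quantitative comparison with `1 / cosh s`, for which `K(T) = 2 a² T`. -/
theorem robin_neg_of_even_one (hf : IsSol (jacobiPotential 1 (-2)) f f')
    (h0 : f 0 = 1) (h0' : f' 0 = 0) : 0 < f catT ∧ catT * f' catT - f catT < 0 := by
  have hT := catT_pos
  have hW0 : f' 0 * (1 / Real.cosh 0) - f 0 * (-Real.sinh 0 / Real.cosh 0 ^ 2) = 0 := by
    simp [h0']
  -- Positivity is needed at `T` itself, so the comparison runs past it.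
  have hp := hf.pos_of_comparison isSol_inv_cosh (T := catT + 1)
    (fun s _ => (jacobiPotential_lt (by norm_num) s).le)
    (fun s _ => one_div_pos.2 (Real.cosh_pos s)) hW0 (eventually_pos_of_one hf h0)
      catT ⟨catT_pos, lt_add_one _⟩
  have key := hf.mul_wronskian_lt isSol_inv_cosh catT_pos
    (fun s _ => jacobiPotential_lt (by norm_num) s)
    (fun s _ => one_div_pos.2 (Real.cosh_pos s)) hW0 (eventually_pos_of_one hf h0)
    (K := fun s => 2 * catA ^ 2 * s) (fun s => by
      refine ((hasDerivAt_id s).const_mul _).congr_deriv ?_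
      have := Real.cosh_pos s
      simp only [jacobiPotential]
      field_simp
      ring) (by simp)
  refine ⟨hp, ?_⟩
  have hc := Real.cosh_pos catT
  have hc2 : catA ^ 2 * Real.cosh catT ^ 2 * catT ^ 2 = 1 := by
    rw [← mul_pow, catA_mul_cosh]; field_simp
  rw [sinh_catT] at key
  have h2 : catT * Real.cosh catT ^ 2 *
      (1 / Real.cosh catT * (f' catT * (1 / Real.cosh catT) -
        f catT * (-(Real.cosh catT / catT) / Real.cosh catT ^ 2))) =
      catT * f' catT + f catT := by
    field_simp
    ring
  have h3 := mul_lt_mul_of_pos_left key (by positivity : 0 < catT * Real.cosh catT ^ 2)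
  rw [h2] at h3
  have h4 : catT * Real.cosh catT ^ 2 * (f catT * (2 * catA ^ 2 * catT)) = 2 * f catT := by
    linear_combination 2 * f catT * hc2
  linarith

/-- Quantitative comparison with `tanh s`, for which `K(T) = a² (sinh T cosh T - T)`. -/
theorem robin_neg_of_odd (hf : IsSol (jacobiPotential 0 (-2)) f f')
    (h0 : f 0 = 0) (h0' : f' 0 = 1) : catT * f' catT - f catT < 0 := by
  have hT := catT_pos
  have key := hf.mul_wronskian_lt isSol_tanh catT_pos
    (fun s _ => jacobiPotential_lt (by norm_num) s)
    (fun s hs => tanh_pos hs.1) (by simp [h0]) (eventually_pos_of_deriv_one hf h0 h0')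
    (K := fun s => catA ^ 2 * (Real.sinh s * Real.cosh s - s)) (fun s => by
      refine ((((Real.hasDerivAt_sinh s).mul (Real.hasDerivAt_cosh s)).sub
        (hasDerivAt_id s)).const_mul _).congr_deriv ?_
      have := Real.cosh_pos s
      simp only [jacobiPotential, Real.tanh_eq_sinh_div_cosh]
      field_simp
      rw [Real.cosh_sq]
      ring) (by simp)
  have hc := Real.cosh_pos catT
  have hc2 := cosh_catT_sq
  have hc3 : 1 / Real.cosh catT ^ 2 = (catT ^ 2 - 1) / catT ^ 2 := by
    field_simp
    linear_combination -hc2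
  have hc4 : catA ^ 2 * (Real.sinh catT * Real.cosh catT - catT) = (2 - catT ^ 2) / catT ^ 3 := by
    rw [sinh_catT, catA_sq]
    field_simp
    linear_combination hc2
  simp only [hc3, hc4, tanh_catT] at key
  have h3 := mul_lt_mul_of_pos_left key (by positivity : 0 < catT ^ 3)
  have h4 : catT ^ 3 * (1 / catT * (f' catT * (1 / catT) - f catT * ((catT ^ 2 - 1) / catT ^ 2))) =
      catT * f' catT - f catT * (catT ^ 2 - 1) := by
    field_simp
  have h5 : catT ^ 3 * (f catT * ((2 - catT ^ 2) / catT ^ 3)) = f catT * (2 - catT ^ 2) := by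
    field_simp
  rw [h4, h5] at h3
  linarith

/-- For even `f` and `n = 0`, positivity of `f` follows by comparison with `1 - s tanh s`; the
bound is then inherited from the mode `n = 1`, whose potential is larger. -/
theorem robin_neg_of_even_zero {g g' : ℝ → ℝ} (hf : IsSol (jacobiPotential 0 (-2)) f f')
    (h0 : f 0 = 1) (h0' : f' 0 = 0) (hg : IsSol (jacobiPotential 1 (-2)) g g')
    (hg0 : g 0 = 1) (hg0' : g' 0 = 0) : catT * f' catT - f catT < 0 := by
  have hT := catT_pos
  have hhp : ∀ s ∈ Set.Ioo 0 catT, 0 < 1 - s * Real.tanh s := by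
    intro s hs
    have h1 : Real.tanh s < Real.tanh catT := strictMono_tanh hs.2
    have h2 : 0 < Real.tanh s := tanh_pos hs.1
    have h3 := catT_spec.2
    nlinarith [hs.1, hs.2]
  have hV : ∀ s ∈ Set.Ioo 0 catT, jacobiPotential 0 0 s < jacobiPotential 0 (-2) s :=
    fun s _ => jacobiPotential_lt (by norm_num) s
  have hW0 : f' 0 * (1 - 0 * Real.tanh 0) -
      f 0 * -(Real.tanh 0 + 0 * (1 / Real.cosh 0 ^ 2)) = 0 := by
    simp [h0']
  have hp := hf.pos_of_comparison isSol_support (fun s hs => (hV s hs).le) hhp hW0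
    (eventually_pos_of_one hf h0)
  -- The comparison function vanishes at `T`, so positivity of the Wronskian there is that of `f`.
  have hpT : 0 < f catT := by
    have hW := hf.strictMonoOn_wronskian isSol_support hV hp hhp ⟨le_rfl, hT.le⟩ ⟨hT.le, le_rfl⟩ hT
    replace hW := hW0.symm.trans_lt hW
    simp only [catT_spec.2, sub_self, mul_zero, zero_sub, mul_neg, neg_neg] at hW
    refine pos_of_mul_pos_left hW ?_
    have := tanh_pos hT
    have := Real.cosh_pos catT
    positivity
  have hgp : ∀ s ∈ Set.Ioo 0 catT, 0 < g s :=
    hg.pos_of_comparison isSol_inv_cosh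
      (fun s _ => (jacobiPotential_lt (by norm_num) s).le)
      (fun s _ => one_div_pos.2 (Real.cosh_pos s)) (by simp [hg0']) (eventually_pos_of_one hg hg0)
  have hW := hg.monotoneOn_wronskian hf (T := catT)
    (fun s _ => by simp only [jacobiPotential]; linarith)
    (fun s hs => (hgp s hs).le) (fun s hs => (hp s hs).le) ⟨le_rfl, hT.le⟩ ⟨hT.le, le_rfl⟩ hT.le
  simp only [h0, hg0, h0', hg0'] at hW
  obtain ⟨hgT, hgR⟩ := robin_neg_of_even_one hg hg0 hg0'
  have h1 : (catT * f' catT) * g catT < f catT * g catT := by nlinarith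
  linarith [lt_of_mul_lt_mul_right h1 hgT.le]

end Robin

theorem exists_root_lt_neg_two {F : ℝ → ℝ} (hF : Continuous F) (h1 : 0 ≤ F (-3 / catA ^ 2))
    (h2 : F (-2) < 0) : ∃ γ < -2, F γ = 0 := by
  have hle : -3 / catA ^ 2 ≤ -2 := by
    have := catA_pos
    rw [div_le_iff₀ (by positivity)]
    nlinarith [catA_lt_one]
  obtain ⟨γ, hγ, hγ0⟩ := intermediate_value_Icc' hle hF.continuousOn ⟨h2.le, h1⟩
  exact ⟨γ, hγ.2.lt_of_ne (by rintro rfl; exact h2.ne hγ0), hγ0⟩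

/-- Even solutions of the Robin problem on `[-T, T]`, for `n = 0` and `n = 1`. -/
theorem exists_even_mode {c : ℝ} (hc : c = 0 ∨ c = 1) :
    ∃ γ < -2, ∃ f f' : ℝ → ℝ, IsSol (jacobiPotential c γ) f f' ∧ f 0 = 1 ∧
      (∀ s, f (-s) = f s) ∧ catT * f' catT = f catT := by
  obtain ⟨f, f', hf, hf', h⟩ := exists_even_solution (continuous_jacobiPotential c)
    (jacobiPotential_neg c)
  obtain ⟨g, g', -, -, hg⟩ := exists_even_solution (continuous_jacobiPotential 1)
    (jacobiPotential_neg 1)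
  have hcT : Continuous fun γ : ℝ => (γ, catT) := by fun_prop
  obtain ⟨γ, hγ, h0⟩ := exists_root_lt_neg_two
    (F := fun γ => catT * f' γ catT - f γ catT)
    ((continuous_const.mul (hf'.comp hcT)).sub (hf.comp hcT))
    (robin_nonneg_of_even (by rcases hc with rfl | rfl <;> norm_num) (h _).2.2.2 (h _).1 (h _).2.1)
    (by
      rcases hc with rfl | rfl
      · exact robin_neg_of_even_zero (h _).2.2.2 (h _).1 (h _).2.1 (hg _).2.2.2 (hg _).1 (hg _).2.1
      · exact (robin_neg_of_even_one (h _).2.2.2 (h _).1 (h _).2.1).2)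
  exact ⟨γ, hγ, f γ, f' γ, (h γ).2.2.2, (h γ).1, (h γ).2.2.1, sub_eq_zero.1 h0⟩

/-- An odd solution of the Robin problem on `[-T, T]`, for `n = 0`. -/
theorem exists_odd_mode :
    ∃ γ < -2, ∃ f f' : ℝ → ℝ, IsSol (jacobiPotential 0 γ) f f' ∧ f' 0 = 1 ∧
      (∀ s, f (-s) = -f s) ∧ catT * f' catT = f catT := by
  obtain ⟨f, f', hf, hf', h⟩ := exists_odd_solution (continuous_jacobiPotential 0)
    (jacobiPotential_neg 0)
  have hcT : Continuous fun γ : ℝ => (γ, catT) := by fun_prop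
  obtain ⟨γ, hγ, h0⟩ := exists_root_lt_neg_two
    (F := fun γ => catT * f' γ catT - f γ catT)
    ((continuous_const.mul (hf'.comp hcT)).sub (hf.comp hcT))
    (robin_nonneg_of_odd le_rfl (h _).2.2.2 (h _).1 (h _).2.1)
    (robin_neg_of_odd (h _).2.2.2 (h _).1 (h _).2.1)
  exact ⟨γ, hγ, f γ, f' γ, (h γ).2.2.2, (h γ).2.1, (h γ).2.2.1, sub_eq_zero.1 h0⟩

/-! ### Geometry of the catenoid in coordinates -/

theorem pd_zero {F : Type*} [NormedAddCommGroup F] [NormedSpace ℝ F] (f : ℝ × ℝ → F)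
    (p : ℝ × ℝ) : pd 0 f p = deriv (fun t => f (t, p.2)) p.1 := if_pos rfl

theorem pd_one {F : Type*} [NormedAddCommGroup F] [NormedSpace ℝ F] (f : ℝ × ℝ → F)
    (p : ℝ × ℝ) : pd 1 f p = deriv (fun t => f (p.1, t)) p.2 := if_neg one_ne_zero

theorem hasDerivAt_vec3 {f g h : ℝ → ℝ} {f' g' h' t : ℝ} (hf : HasDerivAt f f' t)
    (hg : HasDerivAt g g' t) (hh : HasDerivAt h h' t) :
    HasDerivAt (fun t => !₂[f t, g t, h t]) !₂[f', g', h'] t := by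
  have h1 : HasDerivAt (fun t => ![f t, g t, h t]) ![f', g', h'] t := by
    refine hasDerivAt_pi.2 fun i => ?_
    fin_cases i
    · exact hf
    · exact hg
    · exact hh
  exact (PiLp.continuousLinearEquiv 2 ℝ (fun _ : Fin 3 => ℝ)).symm.hasFDerivAt.comp_hasDerivAt t h1

theorem catX_eq : catX = fun p => !₂[catA * (Real.cosh p.1 * Real.cos p.2),
    catA * (Real.cosh p.1 * Real.sin p.2), catA * p.1] := by
  funext p
  ext i
  fin_cases i <;> simp [catX]

theorem pd_zero_catX : pd 0 catX = fun p => !₂[catA * (Real.sinh p.1 * Real.cos p.2),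
    catA * (Real.sinh p.1 * Real.sin p.2), catA] := by
  funext p
  rw [pd_zero, catX_eq]
  refine HasDerivAt.deriv ?_
  dsimp only
  exact hasDerivAt_vec3 (((Real.hasDerivAt_cosh p.1).mul_const _).const_mul catA)
    (((Real.hasDerivAt_cosh p.1).mul_const _).const_mul catA)
    (by simpa using (hasDerivAt_id p.1).const_mul catA)

theorem pd_one_catX : pd 1 catX = fun p => !₂[catA * (Real.cosh p.1 * -Real.sin p.2),
    catA * (Real.cosh p.1 * Real.cos p.2), 0] := by
  funext p
  rw [pd_one, catX_eq]
  refine HasDerivAt.deriv ?_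
  dsimp only
  exact hasDerivAt_vec3 (((Real.hasDerivAt_cos p.2).const_mul _).const_mul catA)
    (((Real.hasDerivAt_sin p.2).const_mul _).const_mul catA) (hasDerivAt_const p.2 _)

theorem pd_zero_zero_catX : pd 0 (pd 0 catX) = fun p =>
    !₂[catA * (Real.cosh p.1 * Real.cos p.2), catA * (Real.cosh p.1 * Real.sin p.2), 0] := by
  funext p
  rw [pd_zero, pd_zero_catX]
  refine HasDerivAt.deriv ?_
  dsimp only
  exact hasDerivAt_vec3 (((Real.hasDerivAt_sinh p.1).mul_const _).const_mul catA)
    (((Real.hasDerivAt_sinh p.1).mul_const _).const_mul catA) (hasDerivAt_const p.1 _)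

theorem pd_one_zero_catX : pd 1 (pd 0 catX) = fun p =>
    !₂[catA * (Real.sinh p.1 * -Real.sin p.2), catA * (Real.sinh p.1 * Real.cos p.2), 0] := by
  funext p
  rw [pd_one, pd_zero_catX]
  refine HasDerivAt.deriv ?_
  dsimp only
  exact hasDerivAt_vec3 (((Real.hasDerivAt_cos p.2).const_mul _).const_mul catA)
    (((Real.hasDerivAt_sin p.2).const_mul _).const_mul catA) (hasDerivAt_const p.2 _)

theorem pd_zero_one_catX : pd 0 (pd 1 catX) = fun p =>
    !₂[catA * (Real.sinh p.1 * -Real.sin p.2), catA * (Real.sinh p.1 * Real.cos p.2), 0] := by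
  funext p
  rw [pd_zero, pd_one_catX]
  refine HasDerivAt.deriv ?_
  dsimp only
  exact hasDerivAt_vec3 (((Real.hasDerivAt_cosh p.1).mul_const _).const_mul catA)
    (((Real.hasDerivAt_cosh p.1).mul_const _).const_mul catA) (hasDerivAt_const p.1 _)

theorem pd_one_one_catX : pd 1 (pd 1 catX) = fun p =>
    !₂[catA * (Real.cosh p.1 * -Real.cos p.2), catA * (Real.cosh p.1 * -Real.sin p.2), 0] := by
  funext p
  rw [pd_one, pd_one_catX]
  refine HasDerivAt.deriv ?_
  dsimp only
  exact hasDerivAt_vec3 (((Real.hasDerivAt_sin p.2).fun_neg.const_mul _).const_mul catA)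
    (((Real.hasDerivAt_cos p.2).const_mul _).const_mul catA) (hasDerivAt_const p.2 _)

theorem inner_vec3 (a b c x y z : ℝ) :
    inner ℝ (!₂[a, b, c] : E3) !₂[x, y, z] = a * x + b * y + c * z := by
  simp [PiLp.inner_apply, Fin.sum_univ_three]
  ring

/-- The conformal factor `a² cosh² s` of the metric `a² cosh² s (ds² + dθ²)`. -/
def conf (s : ℝ) : ℝ := catA ^ 2 * Real.cosh s ^ 2

theorem conf_pos (s : ℝ) : 0 < conf s :=
  mul_pos (pow_pos catA_pos 2) (pow_pos (Real.cosh_pos s) 2)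

theorem continuous_conf : Continuous conf := by unfold conf; fun_prop

theorem conf_neg (s : ℝ) : conf (-s) = conf s := by simp [conf]

theorem sqrt_conf (s : ℝ) : √(conf s) = catA * Real.cosh s := by
  rw [conf, ← mul_pow, Real.sqrt_sq (mul_pos catA_pos (Real.cosh_pos s)).le]

theorem firstForm_catX (p : ℝ × ℝ) : firstForm catX p = Matrix.diagonal fun _ => conf p.1 := by
  have h1 := Real.sin_sq_add_cos_sq p.2
  have h2 := Real.cosh_sq p.1
  ext i j
  fin_cases i <;> fin_cases j <;>
    simp only [firstForm, Fin.zero_eta, Fin.mk_one, Matrix.of_apply, pd_zero_catX, pd_one_catX,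
      inner_vec3, Matrix.diagonal_apply_eq, Matrix.diagonal_apply_ne, conf, ne_eq, zero_ne_one,
      one_ne_zero, not_false_eq_true]
  · linear_combination catA ^ 2 * Real.sinh p.1 ^ 2 * h1 - catA ^ 2 * h2
  · ring
  · ring
  · linear_combination catA ^ 2 * Real.cosh p.1 ^ 2 * h1

theorem firstForm_inv_catX (p : ℝ × ℝ) :
    (firstForm catX p)⁻¹ = Matrix.diagonal fun _ => (conf p.1)⁻¹ := by
  refine Matrix.inv_eq_right_inv ?_
  rw [firstForm_catX, Matrix.diagonal_mul_diagonal]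
  simp [(conf_pos p.1).ne']

theorem areaDensity_catX (p : ℝ × ℝ) : areaDensity catX p = conf p.1 := by
  rw [areaDensity, firstForm_catX, Matrix.det_diagonal, Finset.prod_const, Finset.card_univ,
    Fintype.card_fin, Real.sqrt_sq (conf_pos _).le]

theorem cross_catX (p : ℝ × ℝ) : cross (pd 0 catX p) (pd 1 catX p) =
    !₂[-(catA ^ 2 * Real.cosh p.1 * Real.cos p.2), -(catA ^ 2 * Real.cosh p.1 * Real.sin p.2),
      catA ^ 2 * Real.cosh p.1 * Real.sinh p.1] := by
  have h1 := Real.sin_sq_add_cos_sq p.2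
  rw [pd_zero_catX, pd_one_catX, cross]
  ext i
  fin_cases i <;> simp [cross_apply]
  · ring
  · ring
  · linear_combination catA ^ 2 * Real.cosh p.1 * Real.sinh p.1 * h1

theorem norm_cross_catX (p : ℝ × ℝ) : ‖cross (pd 0 catX p) (pd 1 catX p)‖ = conf p.1 := by
  rw [← sq_eq_sq₀ (norm_nonneg _) (conf_pos _).le, ← real_inner_self_eq_norm_sq, cross_catX,
    inner_vec3, conf]
  have h1 := Real.sin_sq_add_cos_sq p.2
  have h2 := Real.cosh_sq p.1
  linear_combination catA ^ 4 * Real.cosh p.1 ^ 2 * h1 - catA ^ 4 * Real.cosh p.1 ^ 2 * h2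

theorem unitNormal_catX (p : ℝ × ℝ) : unitNormal catX p =
    (conf p.1)⁻¹ • !₂[-(catA ^ 2 * Real.cosh p.1 * Real.cos p.2),
      -(catA ^ 2 * Real.cosh p.1 * Real.sin p.2), catA ^ 2 * Real.cosh p.1 * Real.sinh p.1] := by
  rw [unitNormal, norm_cross_catX, cross_catX]

theorem secondForm_catX (p : ℝ × ℝ) : secondForm catX p = Matrix.diagonal ![-catA, catA] := by
  have h1 := Real.sin_sq_add_cos_sq p.2
  have hc := Real.cosh_pos p.1
  have ha := catA_pos
  ext i j
  fin_cases i <;> fin_cases j <;>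
    simp only [secondForm, Fin.zero_eta, Fin.mk_one, Matrix.of_apply, unitNormal_catX,
      pd_zero_zero_catX, pd_one_zero_catX, pd_zero_one_catX, pd_one_one_catX, inner_smul_right,
      inner_vec3, Matrix.diagonal_apply_eq, Matrix.diagonal_apply_ne, conf, ne_eq, zero_ne_one,
      one_ne_zero, not_false_eq_true, Matrix.cons_val_zero, Matrix.cons_val_one]
  · field_simp
    linear_combination -catA * Real.cosh p.1 * h1
  · ring
  · ring
  · field_simp
    linear_combination catA * Real.cosh p.1 * h1

theorem normSqA_catX (p : ℝ × ℝ) : normSqA catX p = 2 / Real.cosh p.1 ^ 2 / conf p.1 := by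
  have hc := Real.cosh_pos p.1
  have ha := catA_pos
  simp only [normSqA, firstForm_inv_catX, secondForm_catX, Fin.sum_univ_two,
    Matrix.diagonal_apply_eq, Matrix.diagonal_apply_ne, ne_eq, zero_ne_one,
    one_ne_zero, not_false_eq_true, Matrix.cons_val_zero, Matrix.cons_val_one, conf]
  field_simp
  ring

theorem gradComp_catX (v : ℝ × ℝ → ℝ) (i : Fin 2) (p : ℝ × ℝ) :
    gradComp catX v i p = (conf p.1)⁻¹ * pd i v p := by
  simp [gradComp, firstForm_inv_catX, Matrix.diagonal_apply]

theorem gradNormSq_catX (v : ℝ × ℝ → ℝ) (p : ℝ × ℝ) :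
    gradNormSq catX v p = (pd 0 v p ^ 2 + pd 1 v p ^ 2) / conf p.1 := by
  simp only [gradNormSq, gradComp_catX, Fin.sum_univ_two]
  ring

theorem laplaceBeltrami_catX (v : ℝ × ℝ → ℝ) (p : ℝ × ℝ) :
    laplaceBeltrami catX v p = -(pd 0 (pd 0 v) p + pd 1 (pd 1 v) p) / conf p.1 := by
  have h : ∀ i, (fun q => areaDensity catX q * gradComp catX v i q) = pd i v := by
    intro i
    funext q
    rw [areaDensity_catX, gradComp_catX, mul_inv_cancel_left₀ (conf_pos _).ne']
  simp only [laplaceBeltrami, h, Fin.sum_univ_two]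
  rw [areaDensity_catX]
  ring

theorem jacobiOp_catX (v : ℝ × ℝ → ℝ) (p : ℝ × ℝ) : jacobiOp catX v p =
    -(pd 0 (pd 0 v) p + pd 1 (pd 1 v) p + 2 / Real.cosh p.1 ^ 2 * v p) / conf p.1 := by
  rw [jacobiOp, laplaceBeltrami_catX, normSqA_catX]
  ring

theorem conormalDeriv_catX (v : ℝ × ℝ → ℝ) (p : ℝ × ℝ) :
    conormalDeriv catX v p = pd 0 v p / (catA * Real.cosh p.1) := by
  have h := Real.mul_self_sqrt (conf_pos p.1).le
  have h0 := Real.sqrt_pos.2 (conf_pos p.1)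
  rw [conormalDeriv, gradComp_catX, firstForm_inv_catX, Matrix.diagonal_apply_eq, Real.sqrt_inv,
    ← sqrt_conf]
  nth_rewrite 1 [← h]
  field_simp

theorem norm_pd_one_catX (p : ℝ × ℝ) : ‖pd 1 catX p‖ = catA * Real.cosh p.1 := by
  rw [← sqrt_conf, norm_eq_sqrt_real_inner, pd_one_catX, inner_vec3, conf]
  congr 1
  linear_combination catA ^ 2 * Real.cosh p.1 ^ 2 * Real.sin_sq_add_cos_sq p.2

theorem catA_mul_cosh_neg : catA * Real.cosh (-catT) = 1 / catT := by
  rw [Real.cosh_neg, catA_mul_cosh]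

/-- Separation of variables: `f(s) w(θ)` with `w'' = -c w` is an eigenfunction of the Robin
problem as soon as `f'' = (c - 2 / cosh² s - γ a² cosh² s) f` and `T f' = ± f` at `s = ± T`. -/
theorem solvesRobin_of_separated {u : E3 → ℝ} {f f' w w' : ℝ → ℝ} {c γ : ℝ}
    (hu : u ∘ catX = fun p => f p.1 * w p.2) (hf : IsSol (jacobiPotential c γ) f f')
    (hw : IsSol (fun _ => -c) w w') (hT : catT * f' catT = f catT)
    (hT' : catT * f' (-catT) = -f (-catT)) : SolvesRobin γ u := by
  have h0 : pd 0 (u ∘ catX) = fun p => f' p.1 * w p.2 := by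
    funext p
    rw [pd_zero, hu]
    refine HasDerivAt.deriv ?_
    dsimp only
    exact (hf p.1).1.mul_const _
  have h1 : pd 1 (u ∘ catX) = fun p => f p.1 * w' p.2 := by
    funext p
    rw [pd_one, hu]
    refine HasDerivAt.deriv ?_
    dsimp only
    exact (hw p.2).1.const_mul _
  have h00 : ∀ p, pd 0 (pd 0 (u ∘ catX)) p = jacobiPotential c γ p.1 * f p.1 * w p.2 := by
    intro p
    rw [pd_zero, h0]
    refine HasDerivAt.deriv ?_
    dsimp only
    exact (hf p.1).2.mul_const _
  have h11 : ∀ p, pd 1 (pd 1 (u ∘ catX)) p = f p.1 * (-c * w p.2) := by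
    intro p
    rw [pd_one, h1]
    refine HasDerivAt.deriv ?_
    dsimp only
    exact (hw p.2).2.const_mul _
  have hup : ∀ p, u (catX p) = f p.1 * w p.2 := fun p => congrFun hu p
  refine ⟨fun p _ => ?_, fun θ => ?_, fun θ => ?_⟩
  · rw [jacobiOp_catX, h00, h11, hup, Function.comp_apply, hup, div_eq_iff (conf_pos _).ne',
      jacobiPotential, conf]
    ring
  · rw [conormalDeriv_catX, h0, hup, catA_mul_cosh]
    simp only [div_div_eq_mul_div, div_one]
    linear_combination w θ * hT
  · rw [conormalDeriv_catX, h0, hup, catA_mul_cosh_neg]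
    simp only [div_div_eq_mul_div, div_one]
    linear_combination -w θ * hT'

/-! ### Integration over the catenoid -/

/-- Integration over `Σ` in the coordinates `(s, θ)`. -/
theorem integral_catArea {g G : ℝ × ℝ → ℝ} (hG : Continuous G) (h : ∀ p, conf p.1 * g p = G p) :
    ∫ p, g p ∂catArea = ∫ s in -catT..catT, ∫ θ in (0 : ℝ)..(2 * Real.pi), G (s, θ) := by
  have hm : Measurable fun p : ℝ × ℝ => ENNReal.ofReal (areaDensity catX p) := by
    simp only [areaDensity_catX]
    exact (continuous_conf.comp continuous_fst).measurable.ennreal_ofReal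
  have hi : MeasureTheory.IntegrableOn G
      (Set.Icc (-catT) catT ×ˢ Set.Ioc 0 (2 * Real.pi)) :=
    (hG.continuousOn.integrableOn_compact (isCompact_Icc.prod isCompact_Icc)).mono_set
      (Set.prod_mono_right Set.Ioc_subset_Icc_self)
  rw [catArea, integral_withDensity_eq_integral_toReal_smul hm
    (Filter.Eventually.of_forall fun _ => ENNReal.ofReal_lt_top)]
  have h' : ∀ p, (ENNReal.ofReal (areaDensity catX p)).toReal • g p = G p := fun p => by
    rw [areaDensity_catX, ENNReal.toReal_ofReal (conf_pos _).le, smul_eq_mul, h]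
  simp only [h']
  rw [MeasureTheory.Measure.volume_eq_prod] at hi ⊢
  rw [MeasureTheory.setIntegral_prod _ hi, intervalIntegral.integral_of_le (by linarith [catT_pos]),
    MeasureTheory.integral_Icc_eq_integral_Ioc]
  simp only [intervalIntegral.integral_of_le Real.two_pi_pos.le]

theorem integral_trig_sq (α β δ : ℝ) :
    ∫ θ in (0 : ℝ)..(2 * Real.pi), (α + β * Real.cos θ + δ * Real.sin θ) ^ 2 =
      2 * Real.pi * α ^ 2 + Real.pi * (β ^ 2 + δ ^ 2) := by
  have hd : ∀ θ ∈ Set.uIcc (0 : ℝ) (2 * Real.pi), HasDerivAt (fun θ =>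
      (α ^ 2 + (β ^ 2 + δ ^ 2) / 2) * θ + (β ^ 2 - δ ^ 2) / 2 * (Real.sin θ * Real.cos θ) + 2 * α * β * Real.sin θ -
      2 * α * δ * Real.cos θ + β * δ * Real.sin θ ^ 2)
      ((α + β * Real.cos θ + δ * Real.sin θ) ^ 2) θ := by
    intro θ _
    have hs := Real.hasDerivAt_sin θ
    have hc := Real.hasDerivAt_cos θ
    refine ((((((hasDerivAt_id θ).const_mul _).add ((hs.mul hc).const_mul _)).add
      (hs.const_mul _)).sub (hc.const_mul _)).add ((hs.pow 2).const_mul _)).congr_deriv ?_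
    push_cast
    linear_combination -((β ^ 2 + δ ^ 2) / 2) * Real.sin_sq_add_cos_sq θ
  rw [intervalIntegral.integral_eq_sub_of_hasDerivAt hd
    (Continuous.intervalIntegrable (by fun_prop) _ _)]
  simp
  ring

theorem integral_odd {g : ℝ → ℝ} (T : ℝ) (hg : ∀ s, g (-s) = -g s) : ∫ s in -T..T, g s = 0 := by
  have h := intervalIntegral.integral_comp_neg (a := -T) (b := T) g
  simp only [hg, intervalIntegral.integral_neg, neg_neg] at h
  linarith

theorem HasDerivAt.neg_of_even {f : ℝ → ℝ} {d d' s : ℝ} (hf : ∀ s, f (-s) = f s)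
    (h : HasDerivAt f d s) (h' : HasDerivAt f d' (-s)) : d' = -d := by
  have := hasDerivAt_comp_neg h'
  simp only [hf] at this
  linarith [this.unique h]

theorem HasDerivAt.eq_of_odd {f : ℝ → ℝ} {d d' s : ℝ} (hf : ∀ s, f (-s) = -f s)
    (h : HasDerivAt f d s) (h' : HasDerivAt f d' (-s)) : d' = d := by
  have := hasDerivAt_comp_neg h'
  simp only [hf] at this
  linarith [this.unique h.neg]

theorem continuous_two_div_cosh_sq : Continuous fun s : ℝ => 2 / Real.cosh s ^ 2 :=
  continuous_const.div (Real.continuous_cosh.pow 2) fun s => (pow_pos (Real.cosh_pos s) 2).ne'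

/-! ### The second variation form on Fourier modes -/

/-- `f` is the radial part of an eigenfunction of the Robin problem with eigenvalue `γ < -2`, the
angular part being `cos (n θ)` or `sin (n θ)` with `c = n²`. -/
structure IsLowMode (c γ : ℝ) (f f' : ℝ → ℝ) : Prop where
  lt : γ < -2
  sol : IsSol (jacobiPotential c γ) f f'
  robin : catT * f' catT = f catT
  robin_neg : catT * f' (-catT) = -f (-catT)
  exists_ne : ∃ s ∈ Set.Icc (-catT) catT, f s ≠ 0

/-- The symmetric bilinear form on functions of `s` induced by the second variation form on the
Fourier modes with `n² = c`, up to a factor that comes from the integration over `θ`. -/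
def radialForm (c : ℝ) (f f' g g' : ℝ → ℝ) : ℝ :=
  (∫ s in -catT..catT, (f' s * g' s + (c - 2 / Real.cosh s ^ 2) * (f s * g s))) -
    (f catT * g catT + f (-catT) * g (-catT)) / catT

/-- The inner product on functions of `s` induced by the area form. -/
def radialInner (f g : ℝ → ℝ) : ℝ := ∫ s in -catT..catT, conf s * (f s * g s)

theorem IsSol.continuous_deriv {V f f' : ℝ → ℝ} (hf : IsSol V f f') : Continuous f' :=
  continuous_iff_continuousAt.2 fun s => (hf s).2.continuousAt

section Modes

variable {c γ : ℝ} {f f' : ℝ → ℝ}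

/-- The weak form of the Robin problem, from `(f f')' = f'² + V f²`. -/
theorem IsLowMode.radialForm_self (h : IsLowMode c γ f f') :
    radialForm c f f' f f' = γ * radialInner f f := by
  have hc := h.sol.continuous
  have hc' := h.sol.continuous_deriv
  have hq := continuous_two_div_cosh_sq
  have hk := continuous_conf
  have hFTC := intervalIntegral.integral_eq_sub_of_hasDerivAt (a := -catT) (b := catT)
    (f := fun s => f s * f' s) (fun s _ => (h.sol s).1.mul (h.sol s).2)
    (Continuous.intervalIntegrable ((hc'.mul hc').add (hc.mul
      ((contDiff_jacobiPotential c γ).continuous.mul hc))) _ _)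
  have hsplit : ∀ s, f' s * f' s + f s * (jacobiPotential c γ s * f s) =
      (f' s * f' s + (c - 2 / Real.cosh s ^ 2) * (f s * f s)) - γ * (conf s * (f s * f s)) := by
    intro s
    rw [jacobiPotential, conf]
    ring
  simp only [hsplit] at hFTC
  rw [intervalIntegral.integral_sub (Continuous.intervalIntegrable (by fun_prop) _ _)
    (Continuous.intervalIntegrable (by fun_prop) _ _), intervalIntegral.integral_const_mul] at hFTC
  have hT := catT_pos
  have h1 : f catT * f' catT = f catT * f catT / catT := by
    rw [eq_div_iff hT.ne']; linear_combination f catT * h.robin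
  have h2 : f (-catT) * f' (-catT) = -(f (-catT) * f (-catT) / catT) := by
    rw [← neg_div, eq_div_iff hT.ne']; linear_combination f (-catT) * h.robin_neg
  rw [h1, h2] at hFTC
  rw [radialForm, radialInner, add_div]
  linarith

theorem IsLowMode.radialInner_self_pos (h : IsLowMode c γ f f') : 0 < radialInner f f := by
  have hc := h.sol.continuous
  have hk := continuous_conf
  obtain ⟨s, hs, hs0⟩ := h.exists_ne
  refine intervalIntegral.integral_pos (by linarith [catT_pos])
    (Continuous.continuousOn (by fun_prop))
    (fun s _ => mul_nonneg (conf_pos s).le (mul_self_nonneg _))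
    ⟨s, hs, mul_pos (conf_pos s) (mul_self_pos.2 hs0)⟩

theorem radialForm_even_odd {g g' : ℝ → ℝ} (hfe : ∀ s, f (-s) = f s)
    (hgo : ∀ s, g (-s) = -g s) (hf : ∀ s, HasDerivAt f (f' s) s)
    (hg : ∀ s, HasDerivAt g (g' s) s) : radialForm c f f' g g' = 0 := by
  rw [radialForm, integral_odd, hfe, hgo]
  · ring
  · intro s
    rw [hfe, hgo, (hf s).neg_of_even hfe (hf (-s)), (hg s).eq_of_odd hgo (hg (-s)), Real.cosh_neg]
    ring

theorem radialInner_even_odd {g : ℝ → ℝ} (hfe : ∀ s, f (-s) = f s) (hgo : ∀ s, g (-s) = -g s) :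
    radialInner f g = 0 :=
  integral_odd _ fun s => by rw [hfe, hgo, conf_neg]; ring

theorem radialForm_combination {g g' : ℝ → ℝ} (x y : ℝ) (hf : Continuous f) (hf' : Continuous f')
    (hg : Continuous g) (hg' : Continuous g') :
    radialForm c (fun s => x * f s + y * g s) (fun s => x * f' s + y * g' s)
      (fun s => x * f s + y * g s) (fun s => x * f' s + y * g' s) =
      x ^ 2 * radialForm c f f' f f' + y ^ 2 * radialForm c g g' g g' +
        2 * x * y * radialForm c f f' g g' := by
  have hq := continuous_two_div_cosh_sq
  simp only [radialForm]
  have h : ∀ s, (x * f' s + y * g' s) * (x * f' s + y * g' s) + (c - 2 / Real.cosh s ^ 2) *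
      ((x * f s + y * g s) * (x * f s + y * g s)) =
      x ^ 2 * (f' s * f' s + (c - 2 / Real.cosh s ^ 2) * (f s * f s)) +
      y ^ 2 * (g' s * g' s + (c - 2 / Real.cosh s ^ 2) * (g s * g s)) +
      2 * x * y * (f' s * g' s + (c - 2 / Real.cosh s ^ 2) * (f s * g s)) := fun s => by ring
  simp only [h]
  rw [intervalIntegral.integral_add (Continuous.intervalIntegrable (by fun_prop) _ _)
      (Continuous.intervalIntegrable (by fun_prop) _ _),
    intervalIntegral.integral_add (Continuous.intervalIntegrable (by fun_prop) _ _)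
      (Continuous.intervalIntegrable (by fun_prop) _ _), intervalIntegral.integral_const_mul,
    intervalIntegral.integral_const_mul, intervalIntegral.integral_const_mul]
  ring

theorem radialInner_combination {g : ℝ → ℝ} (x y : ℝ) (hf : Continuous f) (hg : Continuous g) :
    radialInner (fun s => x * f s + y * g s) (fun s => x * f s + y * g s) =
      x ^ 2 * radialInner f f + y ^ 2 * radialInner g g + 2 * x * y * radialInner f g := by
  have hk := continuous_conf
  simp only [radialInner]
  have h : ∀ s, conf s * ((x * f s + y * g s) * (x * f s + y * g s)) =
      x ^ 2 * (conf s * (f s * f s)) + y ^ 2 * (conf s * (g s * g s)) +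
      2 * x * y * (conf s * (f s * g s)) := fun s => by ring
  simp only [h]
  rw [intervalIntegral.integral_add (Continuous.intervalIntegrable (by fun_prop) _ _)
      (Continuous.intervalIntegrable (by fun_prop) _ _),
    intervalIntegral.integral_add (Continuous.intervalIntegrable (by fun_prop) _ _)
      (Continuous.intervalIntegrable (by fun_prop) _ _), intervalIntegral.integral_const_mul,
    intervalIntegral.integral_const_mul, intervalIntegral.integral_const_mul]

end Modes

section Energy

variable {u : E3 → ℝ} {f f' g g' : ℝ → ℝ} {x y : ℝ}

/-- The `L²` norm of `f(s) + g(s) (x cos θ + y sin θ)`. -/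
theorem integralCat_sq
    (hu : u ∘ catX = fun p => f p.1 + g p.1 * (x * Real.cos p.2 + y * Real.sin p.2))
    (hf : Continuous f) (hg : Continuous g) : integralCat (fun z => u z ^ 2) =
      2 * Real.pi * radialInner f f + Real.pi * (x ^ 2 + y ^ 2) * radialInner g g := by
  have hk := continuous_conf
  have hup : ∀ p, u (catX p) = f p.1 + g p.1 * (x * Real.cos p.2 + y * Real.sin p.2) :=
    fun p => congrFun hu p
  have hθ : ∀ s, ∫ θ in (0 : ℝ)..(2 * Real.pi),
      conf s * (f s + g s * (x * Real.cos θ + y * Real.sin θ)) ^ 2 =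
      2 * Real.pi * (conf s * (f s * f s)) +
        Real.pi * (x ^ 2 + y ^ 2) * (conf s * (g s * g s)) := by
    intro s
    have := integral_trig_sq (f s) (g s * x) (g s * y)
    rw [intervalIntegral.integral_const_mul]
    simp only [mul_add, ← add_assoc, ← mul_assoc] at this ⊢
    rw [this]
    ring
  rw [integralCat, integral_catArea
    (G := fun p => conf p.1 * (f p.1 + g p.1 * (x * Real.cos p.2 + y * Real.sin p.2)) ^ 2)
    (by fun_prop) fun p => by rw [hup]]
  simp only [hθ]
  rw [intervalIntegral.integral_add (Continuous.intervalIntegrable (by fun_prop) _ _)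
    (Continuous.intervalIntegrable (by fun_prop) _ _), intervalIntegral.integral_const_mul,
    intervalIntegral.integral_const_mul]
  rfl

/-- The second variation form on `f(s) + g(s) (x cos θ + y sin θ)`. -/
theorem indexForm_eq
    (hu : u ∘ catX = fun p => f p.1 + g p.1 * (x * Real.cos p.2 + y * Real.sin p.2))
    (hf : ∀ s, HasDerivAt f (f' s) s) (hg : ∀ s, HasDerivAt g (g' s) s)
    (hfc' : Continuous f') (hgc' : Continuous g') : indexForm u =
      2 * Real.pi * radialForm 0 f f' f f' +
        Real.pi * (x ^ 2 + y ^ 2) * radialForm 1 g g' g g' := by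
  have hfc : Continuous f := continuous_iff_continuousAt.2 fun s => (hf s).continuousAt
  have hgc : Continuous g := continuous_iff_continuousAt.2 fun s => (hg s).continuousAt
  have hq := continuous_two_div_cosh_sq
  have hq' := hq.comp (continuous_fst : Continuous (Prod.fst : ℝ × ℝ → ℝ))
  have hup : ∀ p, u (catX p) = f p.1 + g p.1 * (x * Real.cos p.2 + y * Real.sin p.2) :=
    fun p => congrFun hu p
  have h0 : ∀ p, pd 0 (u ∘ catX) p = f' p.1 + g' p.1 * (x * Real.cos p.2 + y * Real.sin p.2) := by
    intro p
    rw [pd_zero, hu]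
    refine HasDerivAt.deriv ?_
    dsimp only
    exact (hf p.1).add ((hg p.1).mul_const _)
  have h1 : ∀ p, pd 1 (u ∘ catX) p = g p.1 * (x * -Real.sin p.2 + y * Real.cos p.2) := by
    intro p
    rw [pd_one, hu]
    refine HasDerivAt.deriv ?_
    dsimp only
    exact ((((Real.hasDerivAt_cos p.2).const_mul x).add
      ((Real.hasDerivAt_sin p.2).const_mul y)).const_mul _).const_add _
  have hθ : ∀ s, ∫ θ in (0 : ℝ)..(2 * Real.pi),
      ((f' s + g' s * (x * Real.cos θ + y * Real.sin θ)) ^ 2 +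
        (g s * (x * -Real.sin θ + y * Real.cos θ)) ^ 2 - 2 / Real.cosh s ^ 2 *
        (f s + g s * (x * Real.cos θ + y * Real.sin θ)) ^ 2) =
      2 * Real.pi * (f' s * f' s + (0 - 2 / Real.cosh s ^ 2) * (f s * f s)) +
        Real.pi * (x ^ 2 + y ^ 2) * (g' s * g' s + (1 - 2 / Real.cosh s ^ 2) * (g s * g s)) := by
    intro s
    have e : ∀ θ, ((f' s + g' s * (x * Real.cos θ + y * Real.sin θ)) ^ 2 +
        (g s * (x * -Real.sin θ + y * Real.cos θ)) ^ 2 - 2 / Real.cosh s ^ 2 *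
        (f s + g s * (x * Real.cos θ + y * Real.sin θ)) ^ 2) =
        (f' s + g' s * x * Real.cos θ + g' s * y * Real.sin θ) ^ 2 +
        (0 + g s * y * Real.cos θ + (-(g s * x)) * Real.sin θ) ^ 2 - 2 / Real.cosh s ^ 2 *
        (f s + g s * x * Real.cos θ + g s * y * Real.sin θ) ^ 2 := fun θ => by ring
    simp only [e]
    rw [intervalIntegral.integral_sub (Continuous.intervalIntegrable (by fun_prop) _ _)
      (Continuous.intervalIntegrable (by fun_prop) _ _),
      intervalIntegral.integral_add (Continuous.intervalIntegrable (by fun_prop) _ _)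
      (Continuous.intervalIntegrable (by fun_prop) _ _), intervalIntegral.integral_const_mul,
      integral_trig_sq, integral_trig_sq, integral_trig_sq]
    ring
  have hb : integralBdry (fun z => u z ^ 2) = 2 * Real.pi *
      ((f catT * f catT + f (-catT) * f (-catT)) / catT) +
      Real.pi * (x ^ 2 + y ^ 2) * ((g catT * g catT + g (-catT) * g (-catT)) / catT) := by
    have e : ∀ s θ : ℝ, (f s + g s * (x * Real.cos θ + y * Real.sin θ)) ^ 2 =
      (f s + g s * x * Real.cos θ + g s * y * Real.sin θ) ^ 2 := fun s θ => by ring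
    simp only [integralBdry, hup, norm_pd_one_catX, Real.cosh_neg, catA_mul_cosh, e,
      intervalIntegral.integral_mul_const, integral_trig_sq]
    ring
  rw [indexForm, hb, integral_catArea
    (G := fun p => (f' p.1 + g' p.1 * (x * Real.cos p.2 + y * Real.sin p.2)) ^ 2 +
        (g p.1 * (x * -Real.sin p.2 + y * Real.cos p.2)) ^ 2 - 2 / Real.cosh p.1 ^ 2 *
        (f p.1 + g p.1 * (x * Real.cos p.2 + y * Real.sin p.2)) ^ 2)
    (by simp only [Function.comp_def] at hq'; fun_prop) fun p => by
      have := (conf_pos p.1).ne'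
      have := (Real.cosh_pos p.1).ne'
      rw [gradNormSq_catX, normSqA_catX, h0, h1, hup]
      field_simp]
  simp only [hθ]
  rw [intervalIntegral.integral_add (Continuous.intervalIntegrable (by fun_prop) _ _)
    (Continuous.intervalIntegrable (by fun_prop) _ _), intervalIntegral.integral_const_mul,
    intervalIntegral.integral_const_mul, radialForm, radialForm]
  ring

end Energy

/-! ### The four eigenfunctions -/

/-- The function on `E3` that restricts to `f(s)` on the catenoid. -/
def axialFun (f : ℝ → ℝ) (z : E3) : ℝ := f (z 2 / catA)

/-- The function on `E3` that restricts to `f(s) cos θ` (for `i = 0`) or `f(s) sin θ` (for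
`i = 1`) on the catenoid; it plays no role for `i = 2`. -/
def dipoleFun (i : Fin 3) (f : ℝ → ℝ) (z : E3) : ℝ :=
  f (z 2 / catA) * (z i / (catA * Real.cosh (z 2 / catA)))

theorem contDiff_axialFun {f : ℝ → ℝ} (hf : ContDiff ℝ ∞ f) : ContDiff ℝ ∞ (axialFun f) :=
  hf.comp (ContDiff.div_const (by fun_prop) _)

theorem contDiff_dipoleFun (i : Fin 3) {f : ℝ → ℝ} (hf : ContDiff ℝ ∞ f) :
    ContDiff ℝ ∞ (dipoleFun i f) := by
  have h2 : ContDiff ℝ ∞ fun z : E3 => z 2 / catA := ContDiff.div_const (by fun_prop) _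
  refine (hf.comp h2).mul (ContDiff.div (by fun_prop)
    (contDiff_const.mul (Real.contDiff_cosh.comp h2)) fun z => ?_)
  exact (mul_pos catA_pos (Real.cosh_pos _)).ne'

theorem axialFun_catX (f : ℝ → ℝ) (p : ℝ × ℝ) : axialFun f (catX p) = f p.1 := by
  have := catA_pos.ne'
  simp [axialFun, catX_eq, this]

theorem dipoleFun_zero_catX (f : ℝ → ℝ) (p : ℝ × ℝ) :
    dipoleFun 0 f (catX p) = f p.1 * Real.cos p.2 := by
  have := catA_pos.ne'
  have := (Real.cosh_pos p.1).ne'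
  simp [dipoleFun, catX_eq]
  field_simp

theorem dipoleFun_one_catX (f : ℝ → ℝ) (p : ℝ × ℝ) :
    dipoleFun 1 f (catX p) = f p.1 * Real.sin p.2 := by
  have := catA_pos.ne'
  have := (Real.cosh_pos p.1).ne'
  simp [dipoleFun, catX_eq]
  field_simp

theorem continuous_catX : Continuous catX := by
  unfold catX
  fun_prop

theorem integrable_mul_of_continuous {φ u : E3 → ℝ}
    (hφ : MeasureTheory.Integrable (φ ∘ catX) catArea) (hu : Continuous u) :
    MeasureTheory.Integrable (fun p => φ (catX p) * u (catX p)) catArea := by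
  have hc : Continuous fun p => u (catX p) := hu.comp continuous_catX
  obtain ⟨C, hC⟩ := ((isCompact_Icc (a := -catT) (b := catT)).prod
    (isCompact_Icc (a := 0) (b := 2 * Real.pi))).exists_bound_of_continuousOn hc.continuousOn
  refine hφ.mul_bdd (c := C) hc.aestronglyMeasurable ?_
  refine (MeasureTheory.withDensity_absolutelyContinuous _ _).ae_le
    ((MeasureTheory.ae_restrict_mem (measurableSet_Icc.prod measurableSet_Ioc)).mono fun p hp => ?_)
  exact hC p ⟨hp.1, Set.Ioc_subset_Icc_self hp.2⟩

theorem exists_isLowMode_even {c : ℝ} (hc : c = 0 ∨ c = 1) :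
    ∃ γ f f', IsLowMode c γ f f' ∧ ∀ s, f (-s) = f s := by
  obtain ⟨γ, hγ, f, f', hf, h0, he, hT⟩ := exists_even_mode hc
  refine ⟨γ, f, f', ⟨hγ, hf, hT, ?_, 0, ⟨by linarith [catT_pos], catT_pos.le⟩, by simp [h0]⟩, he⟩
  rw [(hf catT).1.neg_of_even he (hf (-catT)).1, he, mul_neg, hT]

theorem exists_isLowMode_odd :
    ∃ γ f f', IsLowMode 0 γ f f' ∧ ∀ s, f (-s) = -f s := by
  obtain ⟨γ, hγ, f, f', hf, h0, ho, hT⟩ := exists_odd_mode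
  have hne : ∃ s ∈ Set.Icc (-catT) catT, f s ≠ 0 := by
    by_contra! hcon
    have he : f =ᶠ[nhds 0] fun _ => 0 := by
      filter_upwards [Icc_mem_nhds (by linarith [catT_pos] : -catT < 0) catT_pos] with s hs
      exact hcon s hs
    have := (hf 0).1.unique ((hasDerivAt_const 0 0).congr_of_eventuallyEq he)
    exact one_ne_zero (h0.symm.trans this)
  refine ⟨γ, f, f', ⟨hγ, hf, hT, ?_, hne⟩, ho⟩
  rw [(hf catT).1.eq_of_odd ho (hf (-catT)).1, ho, neg_neg, hT]

/-- The functions `f₀(s)`, `f₁(s)`, `f₂(s) cos θ`, `f₂(s) sin θ` on the catenoid, extended to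
`E3`. -/
def modeFamily (f₀ f₁ f₂ : ℝ → ℝ) : Fin 4 → E3 → ℝ :=
  ![axialFun f₀, axialFun f₁, dipoleFun 0 f₂, dipoleFun 1 f₂]

theorem modeFamily_combination (f₀ f₁ f₂ : ℝ → ℝ) (x : Fin 4 → ℝ) (p : ℝ × ℝ) :
    ∑ i, x i * modeFamily f₀ f₁ f₂ i (catX p) =
      (x 0 * f₀ p.1 + x 1 * f₁ p.1) + f₂ p.1 * (x 2 * Real.cos p.2 + x 3 * Real.sin p.2) := by
  simp only [Fin.sum_univ_four, modeFamily, Matrix.cons_val, axialFun_catX, dipoleFun_zero_catX,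
    dipoleFun_one_catX]
  ring

section Family

variable {γ₀ γ₁ γ₂ : ℝ} {f₀ f₀' f₁ f₁' f₂ f₂' : ℝ → ℝ}

theorem contDiff_modeFamily (h₀ : IsLowMode 0 γ₀ f₀ f₀') (h₁ : IsLowMode 0 γ₁ f₁ f₁')
    (h₂ : IsLowMode 1 γ₂ f₂ f₂') (i : Fin 4) : ContDiff ℝ ∞ (modeFamily f₀ f₁ f₂ i) := by
  have s₀ := contDiff_of_hasDerivAt_second_order (contDiff_jacobiPotential 0 γ₀) h₀.sol
  have s₁ := contDiff_of_hasDerivAt_second_order (contDiff_jacobiPotential 0 γ₁) h₁.sol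
  have s₂ := contDiff_of_hasDerivAt_second_order (contDiff_jacobiPotential 1 γ₂) h₂.sol
  fin_cases i
  · exact contDiff_axialFun s₀
  · exact contDiff_axialFun s₁
  · exact contDiff_dipoleFun 0 s₂
  · exact contDiff_dipoleFun 1 s₂

theorem solvesRobin_modeFamily (h₀ : IsLowMode 0 γ₀ f₀ f₀') (h₁ : IsLowMode 0 γ₁ f₁ f₁')
    (h₂ : IsLowMode 1 γ₂ f₂ f₂') (i : Fin 4) :
    SolvesRobin (![γ₀, γ₁, γ₂, γ₂] i) (modeFamily f₀ f₁ f₂ i) := by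
  have h1 : IsSol (fun _ => -0) (fun _ => 1) (fun _ => 0) := fun s =>
    ⟨hasDerivAt_const s 1, (hasDerivAt_const s 0).congr_deriv (by simp)⟩
  have hcos : IsSol (fun _ => -1) Real.cos (fun s => -Real.sin s) := fun s =>
    ⟨Real.hasDerivAt_cos s, (Real.hasDerivAt_sin s).fun_neg.congr_deriv (by simp)⟩
  have hsin : IsSol (fun _ => -1) Real.sin Real.cos := fun s =>
    ⟨Real.hasDerivAt_sin s, (Real.hasDerivAt_cos s).congr_deriv (by simp)⟩
  fin_cases i
  · exact solvesRobin_of_separated (funext fun p => by simp [axialFun_catX, modeFamily])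
      h₀.sol h1 h₀.robin h₀.robin_neg
  · exact solvesRobin_of_separated (funext fun p => by simp [axialFun_catX, modeFamily])
      h₁.sol h1 h₁.robin h₁.robin_neg
  · exact solvesRobin_of_separated (funext fun p => dipoleFun_zero_catX f₂ p)
      h₂.sol hcos h₂.robin h₂.robin_neg
  · exact solvesRobin_of_separated (funext fun p => dipoleFun_one_catX f₂ p)
      h₂.sol hsin h₂.robin h₂.robin_neg

theorem linearIndependent_modeFamily (h₀ : IsLowMode 0 γ₀ f₀ f₀') (h₁ : IsLowMode 0 γ₁ f₁ f₁')
    (h₂ : IsLowMode 1 γ₂ f₂ f₂') (he : ∀ s, f₀ (-s) = f₀ s) (ho : ∀ s, f₁ (-s) = -f₁ s) :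
    LinearIndependent ℝ
      (fun (i : Fin 4) (z : criticalCatenoid) => modeFamily f₀ f₁ f₂ i z) := by
  rw [Fintype.linearIndependent_iff]
  intro x hx
  have key : ∀ s ∈ Set.Icc (-catT) catT, ∀ θ,
      (x 0 * f₀ s + x 1 * f₁ s) + f₂ s * (x 2 * Real.cos θ + x 3 * Real.sin θ) = 0 := by
    intro s hs θ
    have := congrFun hx ⟨catX (s, θ), (s, θ), ⟨hs, Set.mem_univ _⟩, rfl⟩
    simp only [Finset.sum_apply, Pi.smul_apply, smul_eq_mul, Pi.zero_apply] at this
    rwa [modeFamily_combination] at this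
  have hneg : ∀ s ∈ Set.Icc (-catT) catT, -s ∈ Set.Icc (-catT) catT := fun s hs =>
    ⟨neg_le_neg hs.2, neg_le.1 hs.1⟩
  -- Opposite angles separate `n = 0` from `n = 1`, opposite heights separate even from odd.
  have hA : ∀ s ∈ Set.Icc (-catT) catT, x 0 * f₀ s + x 1 * f₁ s = 0 := by
    intro s hs
    have h1 := key s hs 0
    have h2 := key s hs Real.pi
    simp only [Real.cos_zero, Real.sin_zero, Real.cos_pi, Real.sin_pi] at h1 h2
    linarith
  have hx0 : x 0 = 0 := by
    obtain ⟨s, hs, hs0⟩ := h₀.exists_ne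
    have h1 := hA s hs
    have h2 := hA _ (hneg s hs)
    rw [he, ho] at h2
    exact (mul_eq_zero.1 (by linarith : x 0 * f₀ s = 0)).resolve_right hs0
  have hx1 : x 1 = 0 := by
    obtain ⟨s, hs, hs0⟩ := h₁.exists_ne
    have h1 := hA s hs
    have h2 := hA _ (hneg s hs)
    rw [he, ho] at h2
    exact (mul_eq_zero.1 (by linarith : x 1 * f₁ s = 0)).resolve_right hs0
  obtain ⟨s, hs, hs0⟩ := h₂.exists_ne
  have h1 := key s hs 0
  have h2 := key s hs (Real.pi / 2)
  simp only [hx0, hx1, zero_mul, zero_add, Real.cos_zero, Real.sin_zero, mul_one, mul_zero,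
    add_zero, Real.cos_pi_div_two, Real.sin_pi_div_two] at h1 h2
  have hx2 : x 2 = 0 := (mul_eq_zero.1 h1).resolve_left hs0
  have hx3 : x 3 = 0 := (mul_eq_zero.1 h2).resolve_left hs0
  intro i
  fin_cases i
  · exact hx0
  · exact hx1
  · exact hx2
  · exact hx3

/-- The second variation form is diagonal on the span of the four eigenfunctions, which are
orthogonal in `L²`; hence `Q(u) < -2 ∫ u²` for every nonzero `u` in the span. -/
theorem indexForm_modeFamily_lt (h₀ : IsLowMode 0 γ₀ f₀ f₀') (h₁ : IsLowMode 0 γ₁ f₁ f₁')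
    (h₂ : IsLowMode 1 γ₂ f₂ f₂') (he : ∀ s, f₀ (-s) = f₀ s) (ho : ∀ s, f₁ (-s) = -f₁ s)
    {x : Fin 4 → ℝ} (hx : x ≠ 0) :
    indexForm (fun z => ∑ i, x i * modeFamily f₀ f₁ f₂ i z) <
      -2 * integralCat fun z => (∑ i, x i * modeFamily f₀ f₁ f₂ i z) ^ 2 := by
  have hu : (fun z => ∑ i, x i * modeFamily f₀ f₁ f₂ i z) ∘ catX = fun p =>
      (x 0 * f₀ p.1 + x 1 * f₁ p.1) + f₂ p.1 * (x 2 * Real.cos p.2 + x 3 * Real.sin p.2) :=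
    funext (modeFamily_combination f₀ f₁ f₂ x)
  rw [indexForm_eq (f := fun s => x 0 * f₀ s + x 1 * f₁ s)
      (f' := fun s => x 0 * f₀' s + x 1 * f₁' s) hu
      (fun s => ((h₀.sol s).1.const_mul _).add ((h₁.sol s).1.const_mul _)) (fun s => (h₂.sol s).1)
      ((continuous_const.mul h₀.sol.continuous_deriv).add
        (continuous_const.mul h₁.sol.continuous_deriv)) h₂.sol.continuous_deriv,
    integralCat_sq (f := fun s => x 0 * f₀ s + x 1 * f₁ s) hu
      ((continuous_const.mul h₀.sol.continuous).add (continuous_const.mul h₁.sol.continuous))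
      h₂.sol.continuous,
    radialForm_combination _ _ h₀.sol.continuous h₀.sol.continuous_deriv h₁.sol.continuous
      h₁.sol.continuous_deriv,
    radialInner_combination _ _ h₀.sol.continuous h₁.sol.continuous,
    radialForm_even_odd he ho (fun s => (h₀.sol s).1) (fun s => (h₁.sol s).1),
    radialInner_even_odd he ho, h₀.radialForm_self, h₁.radialForm_self, h₂.radialForm_self]
  have p0 := mul_pos (by linarith [h₀.lt] : 0 < -2 - γ₀) h₀.radialInner_self_pos
  have p1 := mul_pos (by linarith [h₁.lt] : 0 < -2 - γ₁) h₁.radialInner_self_pos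
  have p2 := mul_pos (by linarith [h₂.lt] : 0 < -2 - γ₂) h₂.radialInner_self_pos
  have hpi := Real.pi_pos
  have q0 := mul_nonneg (sq_nonneg (x 0)) p0.le
  have q1 := mul_nonneg (sq_nonneg (x 1)) p1.le
  have q2 := mul_nonneg (sq_nonneg (x 2)) p2.le
  have q3 := mul_nonneg (sq_nonneg (x 3)) p2.le
  have hpos : 0 < 2 * (x 0 ^ 2 * ((-2 - γ₀) * radialInner f₀ f₀)) +
      2 * (x 1 ^ 2 * ((-2 - γ₁) * radialInner f₁ f₁)) +
      x 2 ^ 2 * ((-2 - γ₂) * radialInner f₂ f₂) + x 3 ^ 2 * ((-2 - γ₂) * radialInner f₂ f₂) := by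
    obtain ⟨i, hi⟩ := Function.ne_iff.1 hx
    have hi2 : 0 < x i ^ 2 := by have hi : x i ≠ 0 := hi; positivity
    fin_cases i
    · have := mul_pos hi2 p0
      simp only [Fin.zero_eta] at this
      linarith
    · have := mul_pos hi2 p1
      simp only [Fin.mk_one] at this
      linarith
    · have := mul_pos hi2 p2
      simp only [Fin.reduceFinMk] at this
      linarith
    · have := mul_pos hi2 p2
      simp only [Fin.reduceFinMk] at this
      linarith
  have := mul_pos hpi hpos
  linarith

end Family

end

theorem mainTheorem6 :
    (∃ (γ : Fin 4 → ℝ) (u : Fin 4 → E3 → ℝ),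
      (∀ i, ContDiff ℝ ∞ (u i)) ∧
      (∀ i, SolvesRobin (γ i) (u i)) ∧
      LinearIndependent ℝ (fun (i : Fin 4) (x : criticalCatenoid) => u i x) ∧
      ∀ i, γ i < -2) ∧
    (∀ k : ℕ, k ≤ 3 → ∀ φ : Fin k → E3 → ℝ,
      (∀ i, MeasureTheory.Integrable (φ i ∘ catX) catArea) →
      ∃ u : E3 → ℝ, ContDiff ℝ ∞ u ∧
        (∀ i, integralCat (fun x => φ i x * u x) = 0) ∧
        indexForm u < -2 * integralCat (fun x => u x ^ 2)) := by
  obtain ⟨γ₀, f₀, f₀', h₀, he⟩ := exists_isLowMode_even (Or.inl rfl)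
  obtain ⟨γ₁, f₁, f₁', h₁, ho⟩ := exists_isLowMode_odd
  obtain ⟨γ₂, f₂, f₂', h₂, -⟩ := exists_isLowMode_even (Or.inr rfl)
  have hsm := contDiff_modeFamily h₀ h₁ h₂
  refine ⟨⟨![γ₀, γ₁, γ₂, γ₂], modeFamily f₀ f₁ f₂, hsm, solvesRobin_modeFamily h₀ h₁ h₂,
    linearIndependent_modeFamily h₀ h₁ h₂ he ho, fun i => ?_⟩, fun k hk φ hφ => ?_⟩
  · fin_cases i
    · exact h₀.lt
    · exact h₁.lt
    · exact h₂.lt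
    · exact h₂.lt
  · -- At most three linear conditions on a four-dimensional space have a nonzero solution.
    let M : Matrix (Fin k) (Fin 4) ℝ :=
      Matrix.of fun i j => integralCat fun z => φ i z * modeFamily f₀ f₁ f₂ j z
    have hker : LinearMap.ker M.mulVecLin ≠ ⊥ :=
      LinearMap.ker_ne_bot_of_finrank_lt (by simp; omega)
    obtain ⟨x, hxM, hx⟩ := (Submodule.ne_bot_iff _).1 hker
    refine ⟨fun z => ∑ i, x i * modeFamily f₀ f₁ f₂ i z,
      ContDiff.sum fun i _ => contDiff_const.mul (hsm i), fun i => ?_,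
      indexForm_modeFamily_lt h₀ h₁ h₂ he ho hx⟩
    have hi := congrFun (LinearMap.mem_ker.1 hxM) i
    rw [Matrix.mulVecLin_apply, Matrix.mulVec, dotProduct, Pi.zero_apply] at hi
    rw [← hi, integralCat]
    simp only [Finset.mul_sum, mul_left_comm]
    rw [MeasureTheory.integral_finsetSum _ fun j _ =>
      (integrable_mul_of_continuous (hφ i) (hsm j).continuous).const_mul (x j)]
    refine Finset.sum_congr rfl fun j _ => ?_
    rw [MeasureTheory.integral_const_mul, mul_comm]
    rfl
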